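/- Let $d\ge 0$ be an integer and $r\in\{0,1,2,\dots,\infty\}$. Let $(M,g)$ be a connected time-oriented Lorentzian manifold of dimension $d+2$ (manifold of class $C^{r+2}$, metric of class $C^{r+1}$, signature $(-,+,\dots,+)$), with a complete future-directed lightlike Killing vector field $n$ whose flow makes $\pi:M\to E$ a principal $(\mathbb R,+)$-bundle over a $(d+1)$-dimensional manifold $E$ (all of class $C^{r+2}$). Write $n$ also for the 1-form $g(n,\cdot)$, and assume that $\ker n$ is globally integrable: $n=-\psi\,dt$ with functions $t$ (class $C^{r+2}$) and $\psi>0$ (class $C^{r+1}$) on $M$; $t$ and $\psi$ are constant on the fibres of $\pi$ and are also regarded as functions on $E$. Put $T=t(M)$, $N_\tau=\{t=\tau\}\subset M$, $S_\tau=\{t=\tau\}\subset E$. Let $\omega_t$ be a $C^{r+1}$ one-parameter family of connections on the bundles $\pi_t:N_t\to S_t$ (1-forms on $N_t$, i.e. linear forms on $\ker n$, with $\omega_t(n)=1$ and $L_n\omega_t=0$), and let $\sigma_t:S_t\to N_t$ be a $C^{r+1}$ one-parameter family of sections, i.e. a $C^{r+1}$ section $\sigma:E\to M$ of $\pi$.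 (1) There is a unique $C^{r+1}$ vector field $w$ on $E$ with $\psi\,dt[w]=1$ such that $\omega_t(\cdot)=-g(\cdot,V)$ on $\ker n$ for every vector $V$ with $\pi_*V=w$ (the Newtonian frame associated with $\omega_t$). (2) Let $S$ be the space of this frame, obtained by identifying the slices $S_t$ through the action of $w$; that is, $S$ is the $d$-dimensional quotient manifold (of class $C^{r+1}$) of $E$ by the integral lines of $w$, with surjective submersion $p:E\to S$ of class $C^{r+1}$ whose fibres are the integral lines, and every integral line meets every slice $S_\tau$, $\tau\in T$. Then $T$ is an open interval and the following hold. (a) A positive definite metric $a_t$ on $S$, depending on $t\in T$, is well defined by $a_t(p_*\pi_*W,p_*\pi_*V)=g(W,V)$ for $W,V$ tangent to $N_t$ at the same point, and a 1-form $b_t$ on $S$, depending on $t$, is well defined by $b_t=-\sigma_t^*\omega_t$ (with $S_t$ identified with $S$ through $p$); both are of class $C^r$ on $T\times S$. (b) There is a function $y:M\to\mathbb R$ with $y\circ\sigma=0$ and $dy[n]=1$ such that $m\mapsto(t(m),p(\pi(m)),y(m))$ is a $C^{r+1}$ diffeomorphism $M\cong T\times S\times\mathbb R$, which carries $n$ to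 $\partial/\partial y$. (c) There is a $C^r$ function $U$ on $T\times S$ such that under this diffeomorphism, with $\pi_S=p\circ\pi$ and $n=-\psi\,dt$ ($\psi$ being of class $C^r$ on $T\times S$), $$g=\pi_S^*a_t+n\otimes(dy-\pi_S^*b_t)+(dy-\pi_S^*b_t)\otimes n-(2U+1)\,n\otimes n ,$$ and the vector field obtained from the 1-form $n=-\psi\,dt$ by raising the index is future directed. Hence, if $r\ge 1$, $(M,g)$ is an Eisenhart spacetime: a product $T\times S\times\mathbb R$, with $T\subset\mathbb R$ open and connected and $\dim S=d$, endowed with a metric of the above form in which $a_t$ (positive definite), $b_t$, $U$ and $\psi>0$ are at least of class $C^1$, and time-oriented so that $n$ is future directed. -/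

import Mathlib

open Bundle Manifold Set
open scoped Manifold ContDiff Topology

universe u uM uE uS

noncomputable section

namespace Eisenhart

/-! ### Tensor fields, Lorentzian metrics, spacetimes

Manifolds of dimension `k` are modelled on `EuclideanSpace ℝ (Fin k)`; their class is carried by
`IsManifold (𝓡 k) c M`.  (The extra instance `IsManifold (𝓡 k) 1 M` only serves to give the
tangent bundle its structure.) -/

/-- A field of bilinear forms on the tangent spaces (covariant 2-tensor field). -/
abbrev BilinField (k : ℕ) (M : Type*) [TopologicalSpace M]
    [ChartedSpace (EuclideanSpace ℝ (Fin k)) M] :=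
  ∀ x : M, TangentSpace (𝓡 k) x →L[ℝ] TangentSpace (𝓡 k) x →L[ℝ] ℝ

/-- A vector field. -/
abbrev VField (k : ℕ) (M : Type*) [TopologicalSpace M]
    [ChartedSpace (EuclideanSpace ℝ (Fin k)) M] :=
  ∀ x : M, TangentSpace (𝓡 k) x

/-- A symmetric bilinear form of signature `(-,+,…,+)`: there is a vector `u` with
`B(u,u) < 0`, and `B` is positive definite on the orthogonal complement of `u`. -/
structure IsLorentzForm {V : Type*} [AddCommGroup V] [Module ℝ V] (B : V → V → ℝ) : Prop where
  symm : ∀ v w, B v w = B w v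
  signature : ∃ u, B u u < 0 ∧ ∀ v, v ≠ 0 → B u v = 0 → 0 < B v v

/-- The differential `df` of a real function, as a 1-form. -/
def dReal {k : ℕ} {M : Type*} [TopologicalSpace M] [ChartedSpace (EuclideanSpace ℝ (Fin k)) M]
    (f : M → ℝ) (m : M) : TangentSpace (𝓡 k) m →L[ℝ] ℝ :=
  mfderiv (𝓡 k) 𝓘(ℝ, ℝ) f m

section Spacetime

variable {k : ℕ} {M : Type*} [TopologicalSpace M]
  [ChartedSpace (EuclideanSpace ℝ (Fin k)) M] [IsManifold (𝓡 k) 1 M]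

/-- `g` is a Lorentzian metric of class `C^c`, time oriented by the continuous timelike vector
field `Θ`: a causal vector `X` is future directed when `g(Θ, X) < 0`. -/
structure IsSpacetime (c : ℕ∞ω) (g : BilinField k M) (Θ : VField k M) : Prop where
  contMDiff : ContMDiff (𝓡 k)
    ((𝓡 k).prod 𝓘(ℝ, EuclideanSpace ℝ (Fin k) →L[ℝ] EuclideanSpace ℝ (Fin k) →L[ℝ] ℝ)) c
    (fun x : M ↦ TotalSpace.mk' (EuclideanSpace ℝ (Fin k) →L[ℝ] EuclideanSpace ℝ (Fin k) →L[ℝ] ℝ)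
      (E := fun x : M ↦ TangentSpace (𝓡 k) x →L[ℝ] TangentSpace (𝓡 k) x →L[ℝ] ℝ) x (g x))
  lorentz : ∀ x, IsLorentzForm (fun X Y : TangentSpace (𝓡 k) x ↦ g x X Y)
  timelike : ∀ x, g x (Θ x) (Θ x) < 0
  continuous_orientation : Continuous (fun x : M ↦ (⟨x, Θ x⟩ : TangentBundle (𝓡 k) M))

variable [AddAction ℝ M]

/-- `n` is a complete, future directed, lightlike Killing vector field of `(M, g)`, whose flow
is the action `s +ᵥ m` of `(ℝ,+)`. The Killing equation `L_n g = 0` is expressed by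
`d/ds (φ_s^* g) = 0` at `s = 0`, where `φ_s` is the flow. -/
structure IsLightlikeKilling (g : BilinField k M) (Θ n : VField k M) : Prop where
  flow : ∀ m : M, IsMIntegralCurve (I := 𝓡 k) (fun s : ℝ ↦ s +ᵥ m) n
  lightlike : ∀ m, g m (n m) (n m) = 0
  future : ∀ m, g m (Θ m) (n m) < 0
  killing : ∀ (m : M) (X Y : TangentSpace (𝓡 k) m),
    HasDerivAt (fun s : ℝ ↦ g (s +ᵥ m)
      (mfderiv (𝓡 k) (𝓡 k) (fun x : M ↦ s +ᵥ x) m X)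
      (mfderiv (𝓡 k) (𝓡 k) (fun x : M ↦ s +ᵥ x) m Y)) 0 0

end Spacetime

/-! ### Principal bundles with structure group `(ℝ,+)` -/

/-- `pr : M → E` is a principal bundle of class `C^c` with structure group `(ℝ,+)`: the action is
of class `C^c`, `pr` is onto and invariant, and over a neighbourhood `A` of each point of `E`
there is an equivariant `C^c` diffeomorphism `pr⁻¹(A) ≅ A × ℝ` over `A`. -/
structure IsPrincipalLineBundle {k l : ℕ} {M E : Type*} [TopologicalSpace M]
    [ChartedSpace (EuclideanSpace ℝ (Fin k)) M] [TopologicalSpace E]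
    [ChartedSpace (EuclideanSpace ℝ (Fin l)) E] [AddAction ℝ M]
    (c : ℕ∞ω) (pr : M → E) : Prop where
  contMDiff_action : ContMDiff (𝓘(ℝ, ℝ).prod (𝓡 k)) (𝓡 k) c (fun x : ℝ × M ↦ x.1 +ᵥ x.2)
  contMDiff_proj : ContMDiff (𝓡 k) (𝓡 l) c pr
  surjective : Function.Surjective pr
  invariant : ∀ (s : ℝ) (m : M), pr (s +ᵥ m) = pr m
  locally_trivial : ∀ e : E, ∃ (A : Set E) (χ : OpenPartialHomeomorph M (E × ℝ)),
    IsOpen A ∧ e ∈ A ∧ χ.source = pr ⁻¹' A ∧ χ.target = A ×ˢ univ ∧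
    (∀ m ∈ pr ⁻¹' A, (χ m).1 = pr m) ∧
    (∀ (s : ℝ), ∀ m ∈ pr ⁻¹' A, (χ (s +ᵥ m)).2 = s + (χ m).2) ∧
    ContMDiffOn (𝓡 k) ((𝓡 l).prod 𝓘(ℝ, ℝ)) c χ χ.source ∧
    ContMDiffOn ((𝓡 l).prod 𝓘(ℝ, ℝ)) (𝓡 k) c χ.symm χ.target

/-! ### The distribution `ker n`, time function, connections, Newtonian frames -/

section Geometry

variable {k : ℕ} {M : Type*} [TopologicalSpace M] [ChartedSpace (EuclideanSpace ℝ (Fin k)) M]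

/-- The hyperplane `ker n` at `m`, where `n` denotes also the 1-form `g(n, ·)`. Where
`n = -ψ dt`, it is the tangent space of the leaf `N_t` through `m`. -/
def kerN (g : BilinField k M) (n : VField k M) (m : M) : Submodule ℝ (TangentSpace (𝓡 k) m) :=
  LinearMap.ker (g m (n m) : TangentSpace (𝓡 k) m →ₗ[ℝ] ℝ)

/-- Global integrability of `ker n`: `n = -ψ dt` with `ψ > 0`, `t` of class `C^(c+1)` and
`ψ` of class `C^c`. -/
structure IsGloballyIntegrable (c : ℕ∞ω) (g : BilinField k M) (n : VField k M)
    (t ψ : M → ℝ) : Prop where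
  contMDiff_t : ContMDiff (𝓡 k) 𝓘(ℝ, ℝ) (c + 1) t
  contMDiff_ψ : ContMDiff (𝓡 k) 𝓘(ℝ, ℝ) c ψ
  ψ_pos : ∀ m, 0 < ψ m
  n_eq : ∀ (m : M) (X : TangentSpace (𝓡 k) m),
    g m (n m) X = -(ψ m * dReal t m X)

/-- The function on the base `E` of `pr : M → E` induced by a function on `M` that is constant
on the fibres (such as `t` and `ψ`). -/
def onBase {E : Type*} (pr : M → E) (f : M → ℝ) : E → ℝ := Function.extend pr f 0

/-- A `C^c` one-parameter family of connections `ω_t` on the bundles `π_t : N_t → S_t`. Since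
the leaves `N_t` fill `M` and have tangent spaces `ker n`, the family is the same thing as a
field `om` of linear forms on `ker n`. It must satisfy (a) `ω_t(n) = 1` and (b) `L_n ω_t = 0`,
the Lie derivative being `d/ds (φ_s^* ω_t)` at `s = 0` (the vector `X' s` of `ker n` in `lie`
is the image of `X` under `φ_s`). It is of class `C^c` when it is locally the restriction to
`ker n` of a 1-form of class `C^c`. -/
structure IsConnectionFamily [IsManifold (𝓡 k) 1 M] [AddAction ℝ M] (c : ℕ∞ω)
    (g : BilinField k M) (n : VField k M)
    (om : ∀ m : M, kerN g n m →ₗ[ℝ] ℝ) : Prop where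
  unit : ∀ (m : M) (h : n m ∈ kerN g n m), om m ⟨n m, h⟩ = 1
  lie : ∀ (m : M) (X : kerN g n m) (X' : ∀ s : ℝ, kerN g n (s +ᵥ m)),
    (∀ s, (X' s : TangentSpace (𝓡 k) (s +ᵥ m)) =
      mfderiv (𝓡 k) (𝓡 k) (fun x : M ↦ s +ᵥ x) m X) →
    HasDerivAt (fun s : ℝ ↦ om (s +ᵥ m) (X' s)) 0 0
  contMDiff : ∀ m₀ : M, ∃ (O : Set M) (θ : ∀ m : M, TangentSpace (𝓡 k) m →L[ℝ] ℝ),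
    IsOpen O ∧ m₀ ∈ O ∧
    ContMDiffOn (𝓡 k) ((𝓡 k).prod 𝓘(ℝ, EuclideanSpace ℝ (Fin k) →L[ℝ] ℝ)) c
      (fun m : M ↦ TotalSpace.mk' (EuclideanSpace ℝ (Fin k) →L[ℝ] ℝ)
        (E := fun m : M ↦ TangentSpace (𝓡 k) m →L[ℝ] ℝ) m (θ m)) O ∧
    ∀ m ∈ O, ∀ X : kerN g n m, om m X = θ m X

variable {l : ℕ} {E : Type*} [TopologicalSpace E] [ChartedSpace (EuclideanSpace ℝ (Fin l)) E]

/-- `w` is a Newtonian frame of class `C^c` on `E`: a vector field with `ψ dt[w] = 1`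
(here `t`, `ψ` are the functions on `E`). -/
structure IsNewtonianFrame [IsManifold (𝓡 l) 1 E] (c : ℕ∞ω) (t ψ : E → ℝ) (w : VField l E) :
    Prop where
  contMDiff : ContMDiff (𝓡 l) (𝓡 l).tangent c (fun e : E ↦ (⟨e, w e⟩ : TangentBundle (𝓡 l) E))
  normalized : ∀ e : E, ψ e * dReal t e (w e) = 1

/-- The vector field `w` on `E` and the family of connections `ω_t` are associated:
`ω_t(·) = -g(·, V)` on `ker n` for every representative `V` of `w`. -/
def IsAssociated (g : BilinField k M) (n : VField k M) (pr : M → E)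
    (om : ∀ m : M, kerN g n m →ₗ[ℝ] ℝ) (w : VField l E) : Prop :=
  ∀ (m : M) (V : TangentSpace (𝓡 k) m), mfderiv (𝓡 k) (𝓡 l) pr m V = w (pr m) →
    ∀ X : kerN g n m, om m X = -(g m X V)

/-- `e` and `e'` lie on a common integral line of `w`. -/
def SameIntegralLine (w : VField l E) (e e' : E) : Prop :=
  ∃ (γ : ℝ → E) (J : Set ℝ), IsOpen J ∧ J.OrdConnected ∧
    IsMIntegralCurveOn (I := 𝓡 l) γ w J ∧ e ∈ γ '' J ∧ e' ∈ γ '' J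

variable {d : ℕ} {S : Type*} [TopologicalSpace S] [ChartedSpace (EuclideanSpace ℝ (Fin d)) S]

/-- `S`, with the projection `p : E → S`, is the space of the frame `w`, obtained by identifying
the slices `S_τ = {t = τ}` of `E` with each other through the action of `w`: it is the quotient
manifold (of class `C^c`) of `E` by the integral lines of `w`, that is, `p` is a surjective
`C^c` submersion whose fibres are the integral lines; and each integral line meets each of the
slices `S_τ`, `τ` in the image of `t` (without which the slices could not be identified with
each other). -/
structure IsSpaceOfFrame (c : ℕ∞ω) (t : E → ℝ) (w : VField l E) (p : E → S) : Prop where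
  contMDiff : ContMDiff (𝓡 l) (𝓡 d) c p
  surjective : Function.Surjective p
  submersion : ∀ e : E, Function.Surjective (mfderiv (𝓡 l) (𝓡 d) p e)
  fibres : ∀ e e' : E, p e = p e' ↔ SameIntegralLine w e e'
  meets_slices : ∀ q : S, ∀ τ ∈ range t, ∃ e, p e = q ∧ t e = τ

end Geometry

/-! ### Eisenhart spacetimes -/

/-- The data entering an Eisenhart metric on `T × S × ℝ`, of class `C^r`: a time dependent
positive definite metric `a_t` and a time dependent 1-form `b_t` on `S`, and functions
`U` and `ψ > 0` on `T × S`. -/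
structure EisenhartData (d : ℕ) (r : ℕ∞ω) (T : TopologicalSpace.Opens ℝ) (S : Type*)
    [TopologicalSpace S] [ChartedSpace (EuclideanSpace ℝ (Fin d)) S]
    [IsManifold (𝓡 d) 1 S] where
  /-- the space metric `a_t` -/
  a : ∀ (_ : T) (q : S), TangentSpace (𝓡 d) q →L[ℝ] TangentSpace (𝓡 d) q →L[ℝ] ℝ
  /-- the 1-form `b_t` -/
  b : ∀ (_ : T) (q : S), TangentSpace (𝓡 d) q →L[ℝ] ℝ
  /-- the potential -/
  U : T → S → ℝ
  /-- the factor in `n = -ψ dt` -/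
  ψ : T → S → ℝ
  a_symm : ∀ t q v v', a t q v v' = a t q v' v
  a_pos : ∀ t q v, v ≠ 0 → 0 < a t q v v
  ψ_pos : ∀ t q, 0 < ψ t q
  contMDiff_a : ContMDiff (𝓘(ℝ, ℝ).prod (𝓡 d))
    ((𝓡 d).prod 𝓘(ℝ, EuclideanSpace ℝ (Fin d) →L[ℝ] EuclideanSpace ℝ (Fin d) →L[ℝ] ℝ)) r
    (fun x : T × S ↦ TotalSpace.mk'
      (EuclideanSpace ℝ (Fin d) →L[ℝ] EuclideanSpace ℝ (Fin d) →L[ℝ] ℝ)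
      (E := fun q : S ↦ TangentSpace (𝓡 d) q →L[ℝ] TangentSpace (𝓡 d) q →L[ℝ] ℝ)
      x.2 (a x.1 x.2))
  contMDiff_b : ContMDiff (𝓘(ℝ, ℝ).prod (𝓡 d))
    ((𝓡 d).prod 𝓘(ℝ, EuclideanSpace ℝ (Fin d) →L[ℝ] ℝ)) r
    (fun x : T × S ↦ TotalSpace.mk' (EuclideanSpace ℝ (Fin d) →L[ℝ] ℝ)
      (E := fun q : S ↦ TangentSpace (𝓡 d) q →L[ℝ] ℝ) x.2 (b x.1 x.2))
  contMDiff_U : ContMDiff (𝓘(ℝ, ℝ).prod (𝓡 d)) 𝓘(ℝ, ℝ) r (fun x : T × S ↦ U x.1 x.2)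
  contMDiff_ψ : ContMDiff (𝓘(ℝ, ℝ).prod (𝓡 d)) 𝓘(ℝ, ℝ) r (fun x : T × S ↦ ψ x.1 x.2)

section EisenhartMetric

variable {d : ℕ} {r : ℕ∞ω} {T : TopologicalSpace.Opens ℝ} {S : Type*}
  [TopologicalSpace S] [ChartedSpace (EuclideanSpace ℝ (Fin d)) S] [IsManifold (𝓡 d) 1 S]

/-- The model with corners of `T × S × ℝ`. -/
abbrev modelTSR (d : ℕ) := 𝓘(ℝ, ℝ).prod ((𝓡 d).prod 𝓘(ℝ, ℝ))

/-- The 1-form `n = -ψ dt` on `T × S × ℝ`; a tangent vector there is a triple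
`ξ = (dt[ξ], π_{S*} ξ, dy[ξ])`. -/
def EisenhartData.nForm (D : EisenhartData d r T S) (x : T × S × ℝ)
    (ξ : TangentSpace (modelTSR d) x) : ℝ :=
  -(D.ψ x.1 x.2.1 * (ξ.1 : ℝ))

/-- The 1-form `dy - π_S^* b_t` on `T × S × ℝ`. -/
def EisenhartData.yForm (D : EisenhartData d r T S) (x : T × S × ℝ)
    (ξ : TangentSpace (modelTSR d) x) : ℝ :=
  (ξ.2.2 : ℝ) - D.b x.1 x.2.1 ξ.2.1

/-- The Eisenhart metric
`π_S^* a_t + n ⊗ (dy - π_S^* b_t) + (dy - π_S^* b_t) ⊗ n - (2U + 1) n ⊗ n` on `T × S × ℝ`. -/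
def EisenhartData.metric (D : EisenhartData d r T S) (x : T × S × ℝ)
    (ξ η : TangentSpace (modelTSR d) x) : ℝ :=
  D.a x.1 x.2.1 ξ.2.1 η.2.1 + D.nForm x ξ * D.yForm x η + D.yForm x ξ * D.nForm x η
    - (2 * D.U x.1 x.2.1 + 1) * (D.nForm x ξ * D.nForm x η)

variable {M : Type*} [TopologicalSpace M] [ChartedSpace (EuclideanSpace ℝ (Fin (d + 2))) M]

/-- The diffeomorphism `Φ : M ≅ T × S × ℝ`, with `T` an open interval, carries the metric `g`
to the Eisenhart metric of `D`, and the vector field obtained from `n = -ψ dt` by raising the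
index is future directed. -/
structure IsEisenhartIsometry (D : EisenhartData d r T S)
    (Φ : Diffeomorph (𝓡 (d + 2)) (modelTSR d) M (T × S × ℝ) (r + 1))
    (g : BilinField (d + 2) M) (Θ : VField (d + 2) M) : Prop where
  connected : IsConnected (T : Set ℝ)
  metric_eq : ∀ (m : M) (X Y : TangentSpace (𝓡 (d + 2)) m),
    g m X Y = D.metric (Φ m) (mfderiv (𝓡 (d + 2)) (modelTSR d) Φ m X)
      (mfderiv (𝓡 (d + 2)) (modelTSR d) Φ m Y)
  future : ∀ (m : M) (X : TangentSpace (𝓡 (d + 2)) m),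
    (∀ Y : TangentSpace (𝓡 (d + 2)) m,
      g m X Y = D.nForm (Φ m) (mfderiv (𝓡 (d + 2)) (modelTSR d) Φ m Y)) →
    g m (Θ m) X < 0

end EisenhartMetric



/-- `(M, g)`, time oriented by `Θ`, is an Eisenhart spacetime: it is `T × S × ℝ` with an
Eisenhart metric whose data are at least of class `C^1`. -/
def IsEisenhartSpacetime (d : ℕ) {M : Type*} [TopologicalSpace M]
    [ChartedSpace (EuclideanSpace ℝ (Fin (d + 2))) M]
    (g : BilinField (d + 2) M) (Θ : VField (d + 2) M) : Prop :=
  ∃ (r : ℕ∞) (S : Type u) (_ : TopologicalSpace S)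
    (_ : ChartedSpace (EuclideanSpace ℝ (Fin d)) S) (_ : IsManifold (𝓡 d) 1 S)
    (T : TopologicalSpace.Opens ℝ) (D : EisenhartData d r T S)
    (Φ : Diffeomorph (𝓡 (d + 2)) (modelTSR d) M (T × S × ℝ) (r + 1)),
    1 ≤ r ∧ T2Space S ∧ SecondCountableTopology S ∧ IsManifold (𝓡 d) (r + 1) S ∧
      IsEisenhartIsometry D Φ g Θ

/-! ### The space metric and the Coriolis form of a frame -/

section Induced

variable {d : ℕ} {r : ℕ∞ω} {T : TopologicalSpace.Opens ℝ}
  {M : Type*} [TopologicalSpace M] [ChartedSpace (EuclideanSpace ℝ (Fin (d + 2))) M]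
  {E : Type*} [TopologicalSpace E] [ChartedSpace (EuclideanSpace ℝ (Fin (d + 1))) E]
  {S : Type*} [TopologicalSpace S] [ChartedSpace (EuclideanSpace ℝ (Fin d)) S]
  [IsManifold (𝓡 d) 1 S]

/-- `a_t` is the space metric on `S` induced by `g`: `a_t(u, v) = g(W, V)` for `u, v` tangent to
the slice `S_t` of `E` and any representatives `W, V`; vectors tangent to `S_t` are regarded as
vectors tangent to `S` through the identification `p : S_t → S`. -/
def EisenhartData.IsSpaceMetric (D : EisenhartData d r T S) (g : BilinField (d + 2) M)
    (pr : M → E) (t : E → ℝ) (p : E → S) : Prop :=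
  ∀ (τ : T) (m : M), t (pr m) = τ → ∀ u v : TangentSpace (𝓡 (d + 1)) (pr m),
    dReal t (pr m) u = 0 → dReal t (pr m) v = 0 →
    ∀ W V : TangentSpace (𝓡 (d + 2)) m,
      mfderiv (𝓡 (d + 2)) (𝓡 (d + 1)) pr m W = u → mfderiv (𝓡 (d + 2)) (𝓡 (d + 1)) pr m V = v →
      D.a τ (p (pr m)) (mfderiv (𝓡 (d + 1)) (𝓡 d) p (pr m) u)
        (mfderiv (𝓡 (d + 1)) (𝓡 d) p (pr m) v) = g m W V

/-- `b_t = -σ_t^* ω_t`, where `σ_t` is the restriction of `σ` to the slice `S_t`, and `S_t` is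
identified with `S` through `p`. -/
def EisenhartData.IsCoriolisForm (D : EisenhartData d r T S) (g : BilinField (d + 2) M)
    (n : VField (d + 2) M) (om : ∀ m : M, kerN g n m →ₗ[ℝ] ℝ) (σ : E → M)
    (t : E → ℝ) (p : E → S) : Prop :=
  ∀ (τ : T) (e : E), t e = τ → ∀ u : TangentSpace (𝓡 (d + 1)) e,
    dReal t e u = 0 →
    ∃ h : mfderiv (𝓡 (d + 1)) (𝓡 (d + 2)) σ e u ∈ kerN g n (σ e),
      D.b τ (p e) (mfderiv (𝓡 (d + 1)) (𝓡 d) p e u) =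
        -(om (σ e) ⟨mfderiv (𝓡 (d + 1)) (𝓡 (d + 2)) σ e u, h⟩)

end Induced

end Eisenhart

end

/-! The frame. A linear form on `ker n` extends to a covector, and nondegeneracy of `g` turns it
into a vector `V` with `ω = -g(·, V)` on `ker n`. This `V` is unique modulo the orthogonal
complement of `ker n`, which is the line of `n`, and that line is the kernel of `π_*`; so `π_* V` is
determined by the point of `M`. The flow preserves `g`, `n` and `ω`, hence `π_* V` depends only on
the point of `E` (`exists_frame`). Evaluating `ω` on `n` gives `ψ dt[V] = 1`.

The base. Since `dt[w] > 0`, the function `t` increases strictly along integral lines, so each line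
meets each slice exactly once and `(t, p)` is a bijection `E → T × S`. The kernel of `dp` is spanned
by `w`, on which `dt` does not vanish, so the differentials are invertible and the inverse function
theorem applies (`IsSpaceOfFrame.exists_diffeomorph`).

The metric. Let `y` be the fibre coordinate vanishing on `σ`. Every vector `X` is the translate of
`σ_* u + dy[X] n` with `u = π_* X`; invariance and nullity of `n` give `g(X, X') = g(σ_* u, σ_* u')
+ dy[X] n(σ_* u') + dy[X'] n(σ_* u)` (`metric_eq_of_proj`). What is left is the pull back of `g` to
`T × S` by the section. Its space-space, time-space and time-time parts define `a`, `b` and `U`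
(`pullback_apply`), one derivative being lost. The form `a` is positive because vectors of `ker n`
that are not multiples of `n` are spacelike. Finally `b = -σ^* ω`, because `ψ⁻¹ ∂/∂t` corresponds to
`w` and `ω = -g(·, σ_* w)` on `ker n`. -/

namespace Eisenhart

/-! ### Linear algebra of Lorentzian forms -/

section Lorentz

variable {V : Type*} [AddCommGroup V] [Module ℝ V] [TopologicalSpace V]
  {B : V →L[ℝ] V →L[ℝ] ℝ}

theorem IsLorentzForm.eq_zero_of_forall (hB : IsLorentzForm (fun v w ↦ B v w)) {v : V}
    (hv : ∀ w, B v w = 0) : v = 0 := by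
  obtain ⟨u, -, hpos⟩ := hB.signature
  by_contra h
  have := hpos v h (by rw [hB.symm]; exact hv u)
  rw [hv v] at this
  exact lt_irrefl _ this

/-- A vector orthogonal to a null vector `n`, and not a multiple of it, is spacelike. -/
theorem IsLorentzForm.pos_of_orthogonal_null (hB : IsLorentzForm (fun v w ↦ B v w)) {n X : V}
    (hn0 : n ≠ 0) (hn : B n n = 0) (hX : B n X = 0) (hXn : ∀ c : ℝ, X ≠ c • n) : 0 < B X X := by
  obtain ⟨u, hu, hpos⟩ := hB.signature
  have hun : B u n ≠ 0 := fun h ↦ by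
    have := hpos n hn0 h
    rw [hn] at this
    exact lt_irrefl _ this
  have hXn' : B X n = 0 := by rw [hB.symm]; exact hX
  -- The multiple of `n` is chosen to make the vector orthogonal to the timelike `u`; as `n` is null
  -- and orthogonal to `X`, subtracting it does not change the square of `X`.
  have h := hpos (X - (B u X / B u n) • n) (sub_ne_zero.2 (hXn _)) (by
    rw [map_sub, map_smul, smul_eq_mul]; field_simp; ring)
  simpa [hn, hX, hXn'] using h

/-- The orthogonal complement of the hyperplane orthogonal to `n ≠ 0` is spanned by `n`. -/
theorem IsLorentzForm.eq_smul_of_forall_ker (hB : IsLorentzForm (fun v w ↦ B v w)) {n v : V}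
    (hv : ∀ w, B n w = 0 → B v w = 0) : ∃ c : ℝ, v = c • n := by
  let L (x : V) : V →ₗ[ℝ] ℝ := B x
  have hle : LinearMap.ker (L n) ≤ LinearMap.ker (L v) := fun w hw ↦ hv w hw
  have hspan : L v ∈ Submodule.span ℝ {L n} := by
    simpa using mem_span_of_iInf_ker_le_ker (L := fun _ : Unit ↦ L n) (K := L v) (by simpa using hle)
  obtain ⟨c, hc⟩ := Submodule.mem_span_singleton.1 hspan
  refine ⟨c, sub_eq_zero.1 (hB.eq_zero_of_forall fun w ↦ ?_)⟩
  have h : c * B n w = B v w := LinearMap.congr_fun hc w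
  simp [h]

end Lorentz

/-! ### Smoothness criteria for fields of linear maps -/

section Smoothness

variable {EM HM M : Type*} [NormedAddCommGroup EM] [NormedSpace ℝ EM] [TopologicalSpace HM]
  {IM : ModelWithCorners ℝ EM HM} [TopologicalSpace M] [ChartedSpace HM M]

/-- In finite dimension a linear map is the image, under a fixed continuous linear map `Ψ`, of its
values on a basis. -/
theorem contMDiffAt_clm_of_apply {F₁ F₂ : Type*} [NormedAddCommGroup F₁] [NormedSpace ℝ F₁]
    [NormedAddCommGroup F₂] [NormedSpace ℝ F₂] [FiniteDimensional ℝ F₁] {n : ℕ∞ω}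
    {A : M → F₁ →L[ℝ] F₂} {x : M}
    (h : ∀ v, ContMDiffAt IM 𝓘(ℝ, F₂) n (fun m ↦ A m v) x) :
    ContMDiffAt IM 𝓘(ℝ, F₁ →L[ℝ] F₂) n A x := by
  let b := Module.finBasis ℝ F₁
  let Ψ : (Fin (Module.finrank ℝ F₁) → F₂) →L[ℝ] (F₁ →L[ℝ] F₂) :=
    ∑ i, (ContinuousLinearMap.smulRightL ℝ F₁ F₂ (b.coord i).toContinuousLinearMap).comp
      (ContinuousLinearMap.proj i)
  have hA : A = fun m ↦ Ψ (fun i ↦ A m (b i)) := by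
    funext m
    ext v
    simp only [Ψ, _root_.sum_apply, ContinuousLinearMap.comp_apply,
      ContinuousLinearMap.proj_apply, ContinuousLinearMap.smulRightL_apply_apply,
      ContinuousLinearMap.smulRight_apply, LinearMap.coe_toContinuousLinearMap',
      Module.Basis.coord_apply]
    conv_lhs => rw [← b.sum_repr v, map_sum]
    simp
  rw [hA]
  exact Ψ.contMDiff.contMDiffAt.comp x (contMDiffAt_pi_space.2 fun i ↦ h (b i))

variable {EB HB B : Type*} [NormedAddCommGroup EB] [NormedSpace ℝ EB] [TopologicalSpace HB]
  {IB : ModelWithCorners ℝ EB HB} [TopologicalSpace B] [ChartedSpace HB B]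
  {F₁ F₂ : Type*} [NormedAddCommGroup F₁] [NormedSpace ℝ F₁]
  [NormedAddCommGroup F₂] [NormedSpace ℝ F₂]
  {E₁ E₂ : B → Type*} [∀ x, AddCommGroup (E₁ x)] [∀ x, Module ℝ (E₁ x)]
  [TopologicalSpace (TotalSpace F₁ E₁)] [∀ x, TopologicalSpace (E₁ x)]
  [∀ x, AddCommGroup (E₂ x)] [∀ x, Module ℝ (E₂ x)]
  [TopologicalSpace (TotalSpace F₂ E₂)] [∀ x, TopologicalSpace (E₂ x)]
  [FiberBundle F₁ E₁] [VectorBundle ℝ F₁ E₁] [FiberBundle F₂ E₂] [VectorBundle ℝ F₂ E₂]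
  [∀ x, IsTopologicalAddGroup (E₂ x)] [∀ x, ContinuousSMul ℝ (E₂ x)]

/-- A field of linear maps out of a vector bundle of finite rank is `C^n` when its values on all
`C^n` fields of vectors are. -/
theorem contMDiffAt_hom_bundle_of_apply [FiniteDimensional ℝ F₁] {n : ℕ∞ω}
    {b : M → B} {ϕ : ∀ m, E₁ (b m) →L[ℝ] E₂ (b m)} {x : M} (hb : ContMDiffAt IM IB n b x)
    (h : ∀ v : ∀ m, E₁ (b m),
      ContMDiffAt IM (IB.prod 𝓘(ℝ, F₁)) n (fun m ↦ TotalSpace.mk' F₁ (b m) (v m)) x →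
      ContMDiffAt IM (IB.prod 𝓘(ℝ, F₂)) n (fun m ↦ TotalSpace.mk' F₂ (b m) (ϕ m (v m))) x) :
    ContMDiffAt IM (IB.prod 𝓘(ℝ, F₁ →L[ℝ] F₂)) n
      (fun m ↦ TotalSpace.mk' (F₁ →L[ℝ] F₂) (E := fun y : B ↦ E₁ y →L[ℝ] E₂ y) (b m) (ϕ m)) x := by
  rw [contMDiffAt_hom_bundle]
  refine ⟨hb, contMDiffAt_clm_of_apply fun v₀ ↦ ?_⟩
  set e₁ := trivializationAt F₁ E₁ (b x)
  set e₂ := trivializationAt F₂ E₂ (b x)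
  have hm₁ : ∀ᶠ m in 𝓝 x, b m ∈ e₁.baseSet := hb.continuousAt.eventually
    (e₁.open_baseSet.mem_nhds (FiberBundle.mem_baseSet_trivializationAt' (b x)))
  have hm₂ : ∀ᶠ m in 𝓝 x, b m ∈ e₂.baseSet := hb.continuousAt.eventually
    (e₂.open_baseSet.mem_nhds (FiberBundle.mem_baseSet_trivializationAt' (b x)))
  -- It suffices to test on the fields that are constant in the trivialization: they give the
  -- columns of the coordinate matrix of `ϕ`.
  have hv : ContMDiffAt IM (IB.prod 𝓘(ℝ, F₁)) n
      (fun m ↦ TotalSpace.mk' F₁ (b m) (e₁.symm (b m) v₀)) x := by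
    rw [contMDiffAt_totalSpace]
    refine ⟨hb, contMDiffAt_const (c := v₀) |>.congr_of_eventuallyEq ?_⟩
    filter_upwards [hm₁] with m hm
    exact congrArg Prod.snd (e₁.apply_mk_symm hm v₀)
  have h2 := (contMDiffAt_totalSpace.1 (h _ hv)).2
  refine h2.congr_of_eventuallyEq ?_
  filter_upwards [hm₁, hm₂] with m hm hm'
  rw [ContinuousLinearMap.inCoordinates_eq hm hm']
  simp [e₁, e₂]

/-- If a `C^n` field of isomorphisms of vector bundles sends a field of vectors to a `C^n` field of
vectors, then the former field of vectors is `C^n`. -/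
theorem contMDiffAt_of_clm_bundle_apply [CompleteSpace F₁] {n : ℕ∞ω}
    {b : M → B} {ϕ : ∀ m, E₁ (b m) →L[ℝ] E₂ (b m)} {u : ∀ m, E₁ (b m)} {x : M}
    (hϕ : ContMDiffAt IM (IB.prod 𝓘(ℝ, F₁ →L[ℝ] F₂)) n
      (fun m ↦ TotalSpace.mk' (F₁ →L[ℝ] F₂) (E := fun y : B ↦ E₁ y →L[ℝ] E₂ y) (b m) (ϕ m)) x)
    (hinv : ∀ m, (ϕ m).IsInvertible)
    (hu : ContMDiffAt IM (IB.prod 𝓘(ℝ, F₂)) n (fun m ↦ TotalSpace.mk' F₂ (b m) (ϕ m (u m))) x) :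
    ContMDiffAt IM (IB.prod 𝓘(ℝ, F₁)) n (fun m ↦ TotalSpace.mk' F₁ (b m) (u m)) x := by
  rw [contMDiffAt_hom_bundle] at hϕ
  obtain ⟨hb, hA⟩ := hϕ
  rw [contMDiffAt_totalSpace] at hu ⊢
  refine ⟨hb, ?_⟩
  set e₁ := trivializationAt F₁ E₁ (b x)
  set e₂ := trivializationAt F₂ E₂ (b x)
  have hm₁ : ∀ᶠ m in 𝓝 x, b m ∈ e₁.baseSet := hb.continuousAt.eventually
    (e₁.open_baseSet.mem_nhds (FiberBundle.mem_baseSet_trivializationAt' (b x)))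
  have hm₂ : ∀ᶠ m in 𝓝 x, b m ∈ e₂.baseSet := hb.continuousAt.eventually
    (e₂.open_baseSet.mem_nhds (FiberBundle.mem_baseSet_trivializationAt' (b x)))
  set A : M → F₁ →L[ℝ] F₂ := fun m ↦
    ContinuousLinearMap.inCoordinates F₁ E₁ F₂ E₂ (b x) (b m) (b x) (b m) (ϕ m) with hAdef
  have hAinv : ∀ m, b m ∈ e₁.baseSet → b m ∈ e₂.baseSet → (A m).IsInvertible := by
    intro m h1 h2
    obtain ⟨Q, hQ⟩ := hinv m
    refine ⟨((e₁.continuousLinearEquivAt ℝ (b m) h1).symm.trans Q).trans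
      (e₂.continuousLinearEquivAt ℝ (b m) h2), ?_⟩
    rw [hAdef]
    simp only
    rw [ContinuousLinearMap.inCoordinates_eq h1 h2, ← hQ]
    rfl
  have hAx := hAinv x hm₁.self_of_nhds hm₂.self_of_nhds
  -- In coordinates `u` is `(A m)⁻¹` applied to `ϕ m (u m)`, and inversion is smooth near an
  -- invertible operator.
  have hinvA : ContMDiffAt IM 𝓘(ℝ, F₂ →L[ℝ] F₁) n (fun m ↦ (A m).inverse) x :=
    (hAx.contDiffAt_map_inverse (n := n)).contMDiffAt.comp x hA
  refine (hinvA.clm_apply hu.2).congr_of_eventuallyEq ?_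
  filter_upwards [hm₁, hm₂] with m h1 h2
  obtain ⟨Q, hQ⟩ := hAinv m h1 h2
  have hAu : A m (e₁ ⟨b m, u m⟩).2 = (e₂ ⟨b m, ϕ m (u m)⟩).2 := by
    rw [hAdef]
    simp only
    rw [ContinuousLinearMap.inCoordinates_eq h1 h2]
    simp [e₁, e₂, h1]
  change (e₁ ⟨b m, u m⟩).2 = (A m).inverse (e₂ ⟨b m, ϕ m (u m)⟩).2
  rw [← hAu, ← hQ, ContinuousLinearMap.inverse_equiv]
  simp

end Smoothness

/-! ### Inverse function theorem on manifolds -/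

section InverseFunction

variable {E₁ H₁ M₁ E₂ H₂ M₂ : Type*} [NormedAddCommGroup E₁] [NormedSpace ℝ E₁]
  [CompleteSpace E₁] [TopologicalSpace H₁] {I : ModelWithCorners ℝ E₁ H₁} [I.Boundaryless]
  [TopologicalSpace M₁] [ChartedSpace H₁ M₁]
  [NormedAddCommGroup E₂] [NormedSpace ℝ E₂] [CompleteSpace E₂]
  [TopologicalSpace H₂] {J : ModelWithCorners ℝ E₂ H₂}
  [TopologicalSpace M₂] [ChartedSpace H₂ M₂]

/-- A left inverse of a `C^n` map with invertible differentials is `C^n`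
at the points of the image. -/
theorem contMDiffAt_leftInverse {n : ℕ∞ω} [IsManifold I n M₁] [IsManifold J n M₂]
    (hn : n ≠ 0) {F : M₁ → M₂} {G : M₂ → M₁} {x : M₁}
    (hF : ContMDiffAt I J n F x) (hd : Function.Bijective (mfderiv I J F x))
    (hG : Function.LeftInverse G F) : ContMDiffAt J I n G (F x) := by
  set φ := extChartAt I x
  set χ := extChartAt J (F x)
  have hF' := (contMDiffAt_iff.1 hF).2
  rw [I.range_eq_univ, contDiffWithinAt_univ] at hF'
  have hfd : fderiv ℝ (χ ∘ F ∘ φ.symm) (φ x) = mfderiv I J F x := by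
    have := (hF.mdifferentiableAt hn).mfderiv
    rw [I.range_eq_univ, fderivWithin_univ] at this
    exact this.symm
  let L : E₁ ≃L[ℝ] E₂ := ContinuousLinearEquiv.ofBijective (mfderiv I J F x)
    (LinearMap.ker_eq_bot.2 hd.1) (LinearMap.range_eq_top.2 hd.2)
  have hL : HasFDerivAt (χ ∘ F ∘ φ.symm) (L : E₁ →L[ℝ] E₂) (φ x) := by
    have := (hF'.differentiableAt hn).hasFDerivAt
    rw [hfd] at this
    exact this
  set h := hF'.toOpenPartialHomeomorph _ hL hn
  have hval : (χ ∘ F ∘ φ.symm) (φ x) = χ (F x) := by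
    simp [φ]
  have hinv : ContDiffAt ℝ n h.symm (χ (F x)) := hval ▸ hF'.to_localInverse hL hn
  have hsymm : h.symm (χ (F x)) = φ x := hval ▸ hF'.localInverse_apply_image hL hn
  have htgt : χ (F x) ∈ h.target := hval ▸ hF'.image_mem_toOpenPartialHomeomorph_target hL hn
  have hχ : ContMDiffAt J 𝓘(ℝ, E₂) n χ (F x) := contMDiffAt_extChartAt
  have hφ : ContMDiffAt 𝓘(ℝ, E₁) I n φ.symm (φ x) :=
    (contMDiffOn_extChartAt_symm x).contMDiffAt (extChartAt_target_mem_nhds x)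
  have hk : ContMDiffAt J I n (fun y ↦ φ.symm (h.symm (χ y))) (F x) := by
    refine ContMDiffAt.comp (F x) (g := φ.symm) (I' := 𝓘(ℝ, E₁)) ?_
      (hinv.contMDiffAt.comp (F x) hχ)
    rw [hsymm]
    exact hφ
  have hkx : φ.symm (h.symm (χ (F x))) = x := by rw [hsymm]; exact extChartAt_to_inv x
  refine hk.congr_of_eventuallyEq ?_
  have e1 : ∀ᶠ y in 𝓝 (F x), y ∈ χ.source := extChartAt_source_mem_nhds (F x)
  have e2 : ∀ᶠ y in 𝓝 (F x), χ y ∈ h.target :=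
    hχ.continuousAt.eventually (h.open_target.mem_nhds htgt)
  have hFk : ContinuousAt (fun y ↦ F (φ.symm (h.symm (χ y)))) (F x) :=
    ContinuousAt.comp (g := F) (by rw [hkx]; exact hF.continuousAt) hk.continuousAt
  have e3 : ∀ᶠ y in 𝓝 (F x), F (φ.symm (h.symm (χ y))) ∈ χ.source :=
    hFk.eventually (by simp only [hkx]; exact extChartAt_source_mem_nhds (F x))
  filter_upwards [e1, e2, e3] with y h1 h2 h3
  -- The local inverse supplies a preimage of `y` under `F`, and the left inverse `G` must return
  -- that preimage; continuity of `G` is thus a consequence.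
  have h4 : χ (F (φ.symm (h.symm (χ y)))) = χ y := h.right_inv h2
  rw [← χ.injOn h3 h1 h4]
  rw [hG]
  rw [χ.injOn h3 h1 h4]

/-- A bijective `C^n` map with invertible differentials is a diffeomorphism. -/
def diffeomorphOfBijective {n : ℕ∞ω} [IsManifold I n M₁] [IsManifold J n M₂]
    (hn : n ≠ 0) (F : M₁ ≃ M₂)
    (hF : ContMDiff I J n F) (hd : ∀ x, Function.Bijective (mfderiv I J F x)) :
    Diffeomorph I J M₁ M₂ n where
  toEquiv := F
  contMDiff_toFun := hF
  contMDiff_invFun := fun y ↦ by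
    obtain ⟨x, rfl⟩ := F.surjective y
    exact contMDiffAt_leftInverse hn (hF x) (hd x) F.left_inv

end InverseFunction

/-! ### The interval `T` as a manifold, and products with it -/

section OpenSubsets

variable {T : TopologicalSpace.Opens ℝ}

theorem extChartAt_opens_real (x y : T) : extChartAt 𝓘(ℝ, ℝ) x y = (y : ℝ) := by
  simp [extChartAt, TopologicalSpace.Opens.chartAt_eq, chartAt_self_eq]

theorem extChartAt_opens_real_symm (x : T) {z : ℝ} (hz : z ∈ T) :
    ((extChartAt 𝓘(ℝ, ℝ) x).symm z : ℝ) = z := by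
  have hs : (⟨z, hz⟩ : T) ∈ (extChartAt 𝓘(ℝ, ℝ) x).source := by
    simp [TopologicalSpace.Opens.chartAt_eq, chartAt_self_eq]
  have := (extChartAt 𝓘(ℝ, ℝ) x).left_inv hs
  rw [extChartAt_opens_real] at this
  exact congrArg Subtype.val this

theorem hasMFDerivAt_opens_real_val (x : T) :
    HasMFDerivAt 𝓘(ℝ, ℝ) 𝓘(ℝ, ℝ) (Subtype.val : T → ℝ) x (ContinuousLinearMap.id ℝ ℝ) := by
  refine ⟨continuous_subtype_val.continuousAt, HasFDerivAt.hasFDerivWithinAt ?_⟩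
  refine HasFDerivAt.congr_of_eventuallyEq (f := id) (hasFDerivAt_id _) ?_
  have : (T : Set ℝ) ∈ 𝓝 (extChartAt 𝓘(ℝ, ℝ) x x) := by
    rw [extChartAt_opens_real]
    exact T.isOpen.mem_nhds x.2
  filter_upwards [this] with z hz
  simpa [writtenInExtChartAt, chartAt_self_eq] using extChartAt_opens_real_symm x hz

variable {EN HN N : Type*} [NormedAddCommGroup EN] [NormedSpace ℝ EN] [TopologicalSpace HN]
  {J : ModelWithCorners ℝ EN HN} [TopologicalSpace N] [ChartedSpace HN N]

theorem contMDiff_opens_real {n : ℕ∞ω} {f : N → T}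
    (hf : ContMDiff J 𝓘(ℝ, ℝ) n (fun x ↦ (f x : ℝ))) : ContMDiff J 𝓘(ℝ, ℝ) n f := by
  intro x
  rw [contMDiffAt_iff_target]
  refine ⟨(continuous_induced_rng.2 hf.continuous).continuousAt, ?_⟩
  refine (hf x).congr_of_eventuallyEq (Filter.Eventually.of_forall fun y ↦ ?_)
  exact extChartAt_opens_real _ _

theorem mfderiv_opens_real {f : N → T} {x : N} (hf : MDifferentiableAt J 𝓘(ℝ, ℝ) f x)
    (X : TangentSpace J x) :
    (mfderiv J 𝓘(ℝ, ℝ) f x X : ℝ) = mfderiv J 𝓘(ℝ, ℝ) (fun y ↦ (f y : ℝ)) x X := by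
  have h := ((hasMFDerivAt_opens_real_val (f x)).comp x hf.hasMFDerivAt).mfderiv
  exact (DFunLike.congr_fun h X).symm

/-- Constant vector fields on an open subset of the line are smooth. -/
theorem contMDiff_const_section_opens_real {n : ℕ∞ω} (c : ℝ) :
    ContMDiff 𝓘(ℝ, ℝ) 𝓘(ℝ, ℝ).tangent n
      (fun x : T ↦ (⟨x, c⟩ : TangentBundle 𝓘(ℝ, ℝ) T)) := by
  intro x
  refine (contMDiffAt_section (E := fun y : T ↦ TangentSpace 𝓘(ℝ, ℝ) y) (s := fun _ ↦ c) x).2 ?_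
  refine contMDiffAt_const (c := c) |>.congr_of_eventuallyEq
    (Filter.Eventually.of_forall fun y ↦ ?_)
  have h : y ∈ (extChartAt 𝓘(ℝ, ℝ) y).source := mem_extChartAt_source y
  exact tangentCoordChange_self (I := 𝓘(ℝ, ℝ)) h

end OpenSubsets

section Products

variable {d : ℕ} {T : TopologicalSpace.Opens ℝ} {S : Type*} [TopologicalSpace S]
  [ChartedSpace (EuclideanSpace ℝ (Fin d)) S] [IsManifold (𝓡 d) 1 S]

/-- Produces the fields on which pulled back metrics are tested: `c = 0` for vectors tangent to the
slices, `c = 1` and `v = 0` for `∂/∂t`. -/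
theorem contMDiffAt_prod_section {n : ℕ∞ω} (c : ℝ) {v : ∀ x : T × S, TangentSpace (𝓡 d) x.2}
    {x : T × S}
    (hv : ContMDiffAt (𝓘(ℝ, ℝ).prod (𝓡 d)) (𝓡 d).tangent n
      (fun x : T × S ↦ (⟨x.2, v x⟩ : TangentBundle (𝓡 d) S)) x) :
    ContMDiffAt (𝓘(ℝ, ℝ).prod (𝓡 d)) (𝓘(ℝ, ℝ).prod (𝓡 d)).tangent n
      (fun x : T × S ↦ (⟨x, (c, v x)⟩ : TangentBundle (𝓘(ℝ, ℝ).prod (𝓡 d)) (T × S))) x := by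
  have h1 : ContMDiffAt (𝓘(ℝ, ℝ).prod (𝓡 d)) 𝓘(ℝ, ℝ).tangent n
      (fun x : T × S ↦ (⟨x.1, c⟩ : TangentBundle 𝓘(ℝ, ℝ) T)) x :=
    (contMDiff_const_section_opens_real c).contMDiffAt.comp x contMDiffAt_fst
  exact (contMDiff_equivTangentBundleProd_symm (I := 𝓘(ℝ, ℝ)) (I' := 𝓡 d) (M := T) (M' := S)
    (n := n)).contMDiffAt.comp x (h1.prodMk hv)

end Products

/-! ### Pull back of a metric -/

section Pullback

variable {EN HN N : Type*} [NormedAddCommGroup EN] [NormedSpace ℝ EN] [TopologicalSpace HN]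
  {J : ModelWithCorners ℝ EN HN} [TopologicalSpace N] [ChartedSpace HN N] [IsManifold J 1 N]
  {k : ℕ} {M : Type*} [TopologicalSpace M] [ChartedSpace (EuclideanSpace ℝ (Fin k)) M]
  [IsManifold (𝓡 k) 1 M]

/-- The pull back of a metric of class `C^n` by a map of class `C^(n+1)` is of class `C^n`. -/
theorem contMDiffAt_pullback {n : ℕ∞ω} {g : BilinField k M}
    (hg : ContMDiff (𝓡 k)
      ((𝓡 k).prod 𝓘(ℝ, EuclideanSpace ℝ (Fin k) →L[ℝ] EuclideanSpace ℝ (Fin k) →L[ℝ] ℝ)) n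
      (fun x : M ↦ TotalSpace.mk'
        (EuclideanSpace ℝ (Fin k) →L[ℝ] EuclideanSpace ℝ (Fin k) →L[ℝ] ℝ)
        (E := fun x : M ↦ TangentSpace (𝓡 k) x →L[ℝ] TangentSpace (𝓡 k) x →L[ℝ] ℝ) x (g x)))
    {G : N → M} (hG : ContMDiff J (𝓡 k) (n + 1) G) {X Y : ∀ x : N, TangentSpace J x} {x : N}
    (hX : ContMDiffAt J J.tangent n (fun x ↦ (⟨x, X x⟩ : TangentBundle J N)) x)
    (hY : ContMDiffAt J J.tangent n (fun x ↦ (⟨x, Y x⟩ : TangentBundle J N)) x) :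
    ContMDiffAt J 𝓘(ℝ, ℝ) n
      (fun x ↦ g (G x) (mfderiv J (𝓡 k) G x (X x)) (mfderiv J (𝓡 k) G x (Y x))) x := by
  have hT := hG.contMDiff_tangentMap (m := n) le_rfl
  have hX' : ContMDiffAt J (𝓡 k).tangent n (fun x ↦
      TotalSpace.mk' (EuclideanSpace ℝ (Fin k)) (E := fun y : M ↦ TangentSpace (𝓡 k) y)
        (G x) (mfderiv J (𝓡 k) G x (X x))) x :=
    hT.contMDiffAt.comp x hX
  have hY' : ContMDiffAt J (𝓡 k).tangent n (fun x ↦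
      TotalSpace.mk' (EuclideanSpace ℝ (Fin k)) (E := fun y : M ↦ TangentSpace (𝓡 k) y)
        (G x) (mfderiv J (𝓡 k) G x (Y x))) x :=
    hT.contMDiffAt.comp x hY
  have hgG := hg.contMDiffAt.comp x (hG.contMDiffAt.of_le (self_le_add_right n 1))
  have := ContMDiffAt.clm_bundle_apply₂ (E₃ := Bundle.Trivial M ℝ) (F₃ := ℝ) hgG hX' hY'
  simp only [contMDiffAt_totalSpace] at this
  exact this.2

end Pullback

/-- Passes from infinitesimal invariance, stated only at parameter `0`, to invariance under the
whole flow. -/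
theorem eq_of_hasDerivAt_zero_shift {f : ℝ → ℝ} (h : ∀ s, HasDerivAt (fun u ↦ f (u + s)) 0 0)
    (s : ℝ) : f s = f 0 := by
  have hf : ∀ s, HasDerivAt f 0 s := fun s ↦ by
    have := HasDerivAt.comp_sub_const s s (f := fun u ↦ f (u + s)) (by simpa using h s)
    simpa using this
  exact is_const_of_deriv_eq_zero (fun s ↦ (hf s).differentiableAt) (fun s ↦ (hf s).deriv) s 0

/-! ### Invariance under the flow of `n` -/

section Flow

variable {k : ℕ} {M : Type*} [TopologicalSpace M]
  [ChartedSpace (EuclideanSpace ℝ (Fin k)) M]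

/-- Tangent spaces at provably equal points are different types; ascribing the vectors to the common
model space makes the comparison expressible. -/
theorem vfield_congr (n : VField k M) {x y : M} (h : x = y) :
    (n x : EuclideanSpace ℝ (Fin k)) = n y := by
  subst h; rfl

theorem bilinField_congr (g : BilinField k M) {x y : M} (h : x = y)
    {X X' Y Y' : EuclideanSpace ℝ (Fin k)} (hX : X = X') (hY : Y = Y') :
    (g x : TangentSpace (𝓡 k) x → TangentSpace (𝓡 k) x →L[ℝ] ℝ) X Y =
      (g y : TangentSpace (𝓡 k) y → TangentSpace (𝓡 k) y →L[ℝ] ℝ) X' Y' := by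
  subst h hX hY; rfl

variable {n : VField k M} {g : BilinField k M} {Θ : VField k M} {t ψ : M → ℝ} {c : ℕ∞ω}

theorem IsGloballyIntegrable.mdifferentiable (ht : IsGloballyIntegrable c g n t ψ) :
    MDifferentiable (𝓡 k) 𝓘(ℝ, ℝ) t :=
  ht.contMDiff_t.mdifferentiable (by simp)

theorem IsGloballyIntegrable.mem_kerN_iff (ht : IsGloballyIntegrable c g n t ψ) {m : M}
    {X : TangentSpace (𝓡 k) m} : X ∈ kerN g n m ↔ dReal t m X = 0 := by
  change g m (n m) X = 0 ↔ _
  rw [ht.n_eq, neg_eq_zero, mul_eq_zero, or_iff_right (ht.ψ_pos m).ne']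

variable [AddAction ℝ M]

theorem contMDiff_translation
    (ha : ContMDiff (𝓘(ℝ, ℝ).prod (𝓡 k)) (𝓡 k) c (fun x : ℝ × M ↦ x.1 +ᵥ x.2)) (s : ℝ) :
    ContMDiff (𝓡 k) (𝓡 k) c (fun x : M ↦ s +ᵥ x) :=
  ha.comp (contMDiff_const.prodMk contMDiff_id)

theorem mfderiv_translation_add
    (hd : ∀ s : ℝ, MDifferentiable (𝓡 k) (𝓡 k) (fun x : M ↦ s +ᵥ x))
    (u s : ℝ) (m : M) (X : TangentSpace (𝓡 k) m) :
    (mfderiv (𝓡 k) (𝓡 k) (fun x : M ↦ (u + s) +ᵥ x) m X : EuclideanSpace ℝ (Fin k)) =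
      mfderiv (𝓡 k) (𝓡 k) (fun x : M ↦ u +ᵥ x) (s +ᵥ m)
        (mfderiv (𝓡 k) (𝓡 k) (fun x : M ↦ s +ᵥ x) m X) := by
  have h : (fun x : M ↦ (u + s) +ᵥ x) = (fun x : M ↦ u +ᵥ x) ∘ (fun x : M ↦ s +ᵥ x) := by
    funext x
    exact add_vadd u s x
  rw [h]
  exact DFunLike.congr_fun (mfderiv_comp m (hd u (s +ᵥ m)) (hd s m)) X

theorem mfderiv_translation_zero (m : M) (X : TangentSpace (𝓡 k) m) :
    (mfderiv (𝓡 k) (𝓡 k) (fun x : M ↦ (0 : ℝ) +ᵥ x) m X : EuclideanSpace ℝ (Fin k)) = X := by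
  have h : (fun x : M ↦ (0 : ℝ) +ᵥ x) = id := by
    funext x
    exact zero_vadd ℝ x
  rw [h]
  exact DFunLike.congr_fun mfderiv_id X

/-- The generator of a flow is invariant under the flow. -/
theorem mfderiv_translation_generator
    (hd : ∀ s : ℝ, MDifferentiable (𝓡 k) (𝓡 k) (fun x : M ↦ s +ᵥ x))
    (hflow : ∀ m : M, IsMIntegralCurve (I := 𝓡 k) (fun s : ℝ ↦ s +ᵥ m) n) (s : ℝ) (m : M) :
    mfderiv (𝓡 k) (𝓡 k) (fun x : M ↦ s +ᵥ x) m (n m) = n (s +ᵥ m) := by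
  -- The orbit at parameter `0` is at `0 +ᵥ m`, which equals `m` but not by definition.
  suffices h : mfderiv (𝓡 k) (𝓡 k) (fun x : M ↦ s +ᵥ x) ((0 : ℝ) +ᵥ m) (n ((0 : ℝ) +ᵥ m)) =
      n (s +ᵥ ((0 : ℝ) +ᵥ m)) by
    rwa [zero_vadd] at h
  have h1 := (hd s ((0 : ℝ) +ᵥ m)).hasMFDerivAt.comp (0 : ℝ) (hflow m 0)
  have h2 := hflow (s +ᵥ m) 0
  have h3 : (fun x : M ↦ s +ᵥ x) ∘ (fun r : ℝ ↦ r +ᵥ m) = fun r : ℝ ↦ r +ᵥ (s +ᵥ m) := by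
    funext r
    exact vadd_comm s r m
  rw [h3] at h1
  have h4 := DFunLike.congr_fun (hasMFDerivAt_unique h1 h2) (1 : ℝ)
  have h5 : mfderiv (𝓡 k) (𝓡 k) (fun x : M ↦ s +ᵥ x) ((0 : ℝ) +ᵥ m)
      ((1 : ℝ) • n ((0 : ℝ) +ᵥ m)) = (1 : ℝ) • n ((0 : ℝ) +ᵥ (s +ᵥ m)) := h4
  rw [one_smul, one_smul] at h5
  exact h5.trans (vfield_congr n (vadd_comm (0 : ℝ) s m))

theorem hasDerivAt_comp_flow
    (hflow : ∀ m : M, IsMIntegralCurve (I := 𝓡 k) (fun s : ℝ ↦ s +ᵥ m) n)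
    {t : M → ℝ} (m : M) (s : ℝ) (ht : MDifferentiableAt (𝓡 k) 𝓘(ℝ, ℝ) t (s +ᵥ m)) :
    HasDerivAt (fun r : ℝ ↦ t (r +ᵥ m)) (dReal t (s +ᵥ m) (n (s +ᵥ m))) s := by
  let L : ℝ →L[ℝ] ℝ := (mfderiv (𝓡 k) 𝓘(ℝ, ℝ) t (s +ᵥ m)).comp
    ((1 : ℝ →L[ℝ] ℝ).smulRight (n (s +ᵥ m)))
  have h : HasFDerivAt (fun r : ℝ ↦ t (r +ᵥ m)) L s :=
    (ht.hasMFDerivAt.comp s (hflow m s)).hasFDerivAt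
  refine h.hasDerivAt.congr_deriv ?_
  change mfderiv (𝓡 k) 𝓘(ℝ, ℝ) t (s +ᵥ m) ((1 : ℝ) • n (s +ᵥ m)) = _
  rw [one_smul]
  rfl

theorem IsLightlikeKilling.ne_zero (hn : IsLightlikeKilling g Θ n) (m : M) : n m ≠ 0 := by
  intro h
  have := hn.future m
  simp [h] at this

/-- By the group law, the derivative at parameter `s` is the Killing equation at `s +ᵥ m` for the
pushed forward vectors. -/
theorem IsLightlikeKilling.metric_invariant (hn : IsLightlikeKilling g Θ n)
    (hd : ∀ s : ℝ, MDifferentiable (𝓡 k) (𝓡 k) (fun x : M ↦ s +ᵥ x))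
    (s : ℝ) (m : M) (X Y : TangentSpace (𝓡 k) m) :
    g (s +ᵥ m) (mfderiv (𝓡 k) (𝓡 k) (fun x : M ↦ s +ᵥ x) m X)
      (mfderiv (𝓡 k) (𝓡 k) (fun x : M ↦ s +ᵥ x) m Y) = g m X Y := by
  have h := eq_of_hasDerivAt_zero_shift (f := fun s : ℝ ↦ g (s +ᵥ m)
      (mfderiv (𝓡 k) (𝓡 k) (fun x : M ↦ s +ᵥ x) m X)
      (mfderiv (𝓡 k) (𝓡 k) (fun x : M ↦ s +ᵥ x) m Y)) (fun s ↦ by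
    refine (hn.killing (s +ᵥ m) (mfderiv (𝓡 k) (𝓡 k) (fun x : M ↦ s +ᵥ x) m X)
      (mfderiv (𝓡 k) (𝓡 k) (fun x : M ↦ s +ᵥ x) m Y)).congr_of_eventuallyEq
      (Filter.Eventually.of_forall fun u ↦ ?_)
    exact bilinField_congr g (add_vadd u s m) (mfderiv_translation_add hd u s m X)
      (mfderiv_translation_add hd u s m Y)) s
  refine h.trans ?_
  exact bilinField_congr g (zero_vadd ℝ m) (mfderiv_translation_zero m X)
    (mfderiv_translation_zero m Y)

theorem IsLightlikeKilling.mfderiv_mem_kerN (hn : IsLightlikeKilling g Θ n)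
    (hd : ∀ s : ℝ, MDifferentiable (𝓡 k) (𝓡 k) (fun x : M ↦ s +ᵥ x))
    (s : ℝ) {m : M} {X : TangentSpace (𝓡 k) m} (hX : X ∈ kerN g n m) :
    mfderiv (𝓡 k) (𝓡 k) (fun x : M ↦ s +ᵥ x) m X ∈ kerN g n (s +ᵥ m) := by
  have h := hn.metric_invariant hd s m (n m) X
  rw [mfderiv_translation_generator hd hn.flow] at h
  exact h.trans hX

/-- `L_n ω = 0` integrates along the flow in the same way as the Killing equation, since `ker n` is
itself preserved. -/
theorem IsConnectionFamily.invariant [IsManifold (𝓡 k) 1 M] {om : ∀ m : M, kerN g n m →ₗ[ℝ] ℝ}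
    (hom : IsConnectionFamily c g n om) (hn : IsLightlikeKilling g Θ n)
    (hd : ∀ s : ℝ, MDifferentiable (𝓡 k) (𝓡 k) (fun x : M ↦ s +ᵥ x))
    (s : ℝ) (m : M) (X : kerN g n m) :
    om (s +ᵥ m) ⟨mfderiv (𝓡 k) (𝓡 k) (fun x : M ↦ s +ᵥ x) m (X : TangentSpace (𝓡 k) m),
      hn.mfderiv_mem_kerN hd s X.2⟩ = om m X := by
  have hcongr : ∀ {x y : M} (_ : x = y) (X : TangentSpace (𝓡 k) x) (Y : TangentSpace (𝓡 k) y)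
      (_ : (X : EuclideanSpace ℝ (Fin k)) = Y) (hX : X ∈ kerN g n x) (hY : Y ∈ kerN g n y),
      om x ⟨X, hX⟩ = om y ⟨Y, hY⟩ := by
    rintro x _ rfl X _ rfl _ _
    rfl
  have h := eq_of_hasDerivAt_zero_shift (f := fun s : ℝ ↦ om (s +ᵥ m)
      ⟨mfderiv (𝓡 k) (𝓡 k) (fun x : M ↦ s +ᵥ x) m (X : TangentSpace (𝓡 k) m),
        hn.mfderiv_mem_kerN hd s X.2⟩) (fun s ↦ by
    refine (hom.lie (s +ᵥ m) ⟨_, hn.mfderiv_mem_kerN hd s X.2⟩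
      (fun u ↦ ⟨_, hn.mfderiv_mem_kerN hd u (hn.mfderiv_mem_kerN hd s X.2)⟩)
      (fun u ↦ rfl)).congr_of_eventuallyEq (Filter.Eventually.of_forall fun u ↦ ?_)
    exact hcongr (add_vadd u s m) _ _ (mfderiv_translation_add hd u s m (X : TangentSpace (𝓡 k) m)) _ _) s
  exact h.trans (hcongr (zero_vadd ℝ m) _ _
    (mfderiv_translation_zero m (X : TangentSpace (𝓡 k) m)) _ _)

/-- Since `n` is null, it lies in `ker n`, so `dt[n] = 0`. -/
theorem IsGloballyIntegrable.t_invariant (ht : IsGloballyIntegrable c g n t ψ)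
    (hn : IsLightlikeKilling g Θ n) (s : ℝ) (m : M) : t (s +ᵥ m) = t m := by
  have h : ∀ r, HasDerivAt (fun r : ℝ ↦ t (r +ᵥ m)) 0 r := fun r ↦ by
    have := hasDerivAt_comp_flow hn.flow m r (ht.mdifferentiable _)
    rwa [ht.mem_kerN_iff.1 (show n (r +ᵥ m) ∈ kerN g n (r +ᵥ m) from hn.lightlike _)] at this
  have := is_const_of_deriv_eq_zero (fun s ↦ (h s).differentiableAt) (fun s ↦ (h s).deriv) s 0
  simpa using this

theorem IsGloballyIntegrable.exists_dReal_ne_zero (ht : IsGloballyIntegrable c g n t ψ)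
    (hn : IsLightlikeKilling g Θ n)
    (hg : ∀ x, IsLorentzForm (fun X Y : TangentSpace (𝓡 k) x ↦ g x X Y)) (m : M) :
    ∃ X : TangentSpace (𝓡 k) m, dReal t m X ≠ 0 := by
  by_contra! h
  refine hn.ne_zero m ((hg m).eq_zero_of_forall fun X ↦ ?_)
  exact (ht.n_eq m X).trans (by rw [h, mul_zero, neg_zero])

theorem IsGloballyIntegrable.dReal_invariant (ht : IsGloballyIntegrable c g n t ψ)
    (hn : IsLightlikeKilling g Θ n)
    (hd : ∀ s : ℝ, MDifferentiable (𝓡 k) (𝓡 k) (fun x : M ↦ s +ᵥ x))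
    (s : ℝ) (m : M) (X : TangentSpace (𝓡 k) m) :
    dReal t (s +ᵥ m) (mfderiv (𝓡 k) (𝓡 k) (fun x : M ↦ s +ᵥ x) m X) = dReal t m X := by
  have h : t ∘ (fun x : M ↦ s +ᵥ x) = t := by
    funext x
    exact ht.t_invariant hn s x
  have h2 := DFunLike.congr_fun (mfderiv_comp m (ht.mdifferentiable (s +ᵥ m)) (hd s m)) X
  rw [h] at h2
  exact h2.symm

/-- The 1-forms `n` and `dt` are both invariant and `dt` vanishes nowhere, so their ratio is
invariant. -/
theorem IsGloballyIntegrable.ψ_invariant (ht : IsGloballyIntegrable c g n t ψ)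
    (hn : IsLightlikeKilling g Θ n)
    (hg : ∀ x, IsLorentzForm (fun X Y : TangentSpace (𝓡 k) x ↦ g x X Y))
    (hd : ∀ s : ℝ, MDifferentiable (𝓡 k) (𝓡 k) (fun x : M ↦ s +ᵥ x))
    (s : ℝ) (m : M) : ψ (s +ᵥ m) = ψ m := by
  obtain ⟨X, hX⟩ := ht.exists_dReal_ne_zero hn hg m
  have h := hn.metric_invariant hd s m (n m) X
  rw [mfderiv_translation_generator hd hn.flow, ht.n_eq, ht.n_eq, ht.dReal_invariant hn hd,
    neg_inj] at h
  exact mul_right_cancel₀ hX h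

end Flow

theorem IsLorentzForm.isInvertible {V : Type*} [NormedAddCommGroup V] [NormedSpace ℝ V]
    [FiniteDimensional ℝ V] {B : V →L[ℝ] V →L[ℝ] ℝ} (hB : IsLorentzForm (fun v w ↦ B v w)) :
    B.IsInvertible := by
  have hinj : Function.Injective B := fun v w h ↦ sub_eq_zero.1
    (hB.eq_zero_of_forall fun u ↦ by simp [h])
  have hfr : Module.finrank ℝ V = Module.finrank ℝ (V →L[ℝ] ℝ) := by
    rw [← (LinearMap.toContinuousLinearMap (𝕜 := ℝ) (E := V) (F' := ℝ)).finrank_eq]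
    exact Subspace.dual_finrank_eq.symm
  refine ⟨(LinearEquiv.ofInjectiveOfFinrankEq (B : V →ₗ[ℝ] V →L[ℝ] ℝ) hinj
    hfr).toContinuousLinearEquiv, ?_⟩
  ext v w
  rfl

/-! ### Principal line bundles with a section -/

namespace IsPrincipalLineBundle

variable {k l : ℕ} {M E : Type*} [TopologicalSpace M]
  [ChartedSpace (EuclideanSpace ℝ (Fin k)) M] [TopologicalSpace E]
  [ChartedSpace (EuclideanSpace ℝ (Fin l)) E] [AddAction ℝ M] {c : ℕ∞ω} {pr : M → E}

theorem exists_vadd_eq (hpr : IsPrincipalLineBundle (k := k) (l := l) c pr) {m m' : M} (h : pr m = pr m') :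
    ∃ s : ℝ, s +ᵥ m = m' := by
  obtain ⟨A, χ, -, heA, hsrc, -, h1, h2, -, -⟩ := hpr.locally_trivial (pr m)
  have hm' : m' ∈ pr ⁻¹' A := by rw [mem_preimage, ← h]; exact heA
  have hs (s : ℝ) : s +ᵥ m ∈ pr ⁻¹' A := by rw [mem_preimage, hpr.invariant]; exact heA
  refine ⟨(χ m').2 - (χ m).2, χ.injOn (hsrc ▸ hs _) (hsrc ▸ hm') (Prod.ext ?_ ?_)⟩
  · rw [h1 _ (hs _), h1 _ hm', hpr.invariant, h]
  · rw [h2 _ m heA, sub_add_cancel]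

theorem vadd_left_injective (hpr : IsPrincipalLineBundle (k := k) (l := l) c pr) {s s' : ℝ} {m : M}
    (h : s +ᵥ m = s' +ᵥ m) : s = s' := by
  obtain ⟨A, χ, -, heA, -, -, -, h2, -, -⟩ := hpr.locally_trivial (pr m)
  have := h2 s m heA
  rw [h, h2 s' m heA] at this
  exact (add_right_cancel this).symm

variable {σ : E → M}

/-- The coordinate along the fibres that vanishes on the section `σ`. -/
noncomputable def fibreCoord (hpr : IsPrincipalLineBundle (k := k) (l := l) c pr) (hσ : ∀ e, pr (σ e) = e) (m : M) : ℝ :=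
  (hpr.exists_vadd_eq (hσ (pr m))).choose

theorem fibreCoord_vadd (hpr : IsPrincipalLineBundle (k := k) (l := l) c pr) (hσ : ∀ e, pr (σ e) = e) (m : M) :
    hpr.fibreCoord hσ m +ᵥ σ (pr m) = m :=
  (hpr.exists_vadd_eq (hσ (pr m))).choose_spec

theorem fibreCoord_vadd_section (hpr : IsPrincipalLineBundle (k := k) (l := l) c pr) (hσ : ∀ e, pr (σ e) = e)
    (s : ℝ) (e : E) : hpr.fibreCoord hσ (s +ᵥ σ e) = s := by
  have h := hpr.fibreCoord_vadd hσ (s +ᵥ σ e)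
  rw [hpr.invariant, hσ] at h
  exact hpr.vadd_left_injective h

theorem fibreCoord_vadd_add (hpr : IsPrincipalLineBundle (k := k) (l := l) c pr) (hσ : ∀ e, pr (σ e) = e)
    (s : ℝ) (m : M) : hpr.fibreCoord hσ (s +ᵥ m) = s + hpr.fibreCoord hσ m := by
  conv_lhs => rw [← hpr.fibreCoord_vadd hσ m, ← add_vadd]
  exact hpr.fibreCoord_vadd_section hσ _ _

/-- In a local trivialization it is the difference of the fibre coordinates of `m` and of `σ (pr
m)`. -/
theorem contMDiff_fibreCoord (hpr : IsPrincipalLineBundle (k := k) (l := l) c pr) (hσ : ∀ e, pr (σ e) = e)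
    {c' : ℕ∞ω} (hc : c' ≤ c) (hσc : ContMDiff (𝓡 l) (𝓡 k) c' σ) :
    ContMDiff (𝓡 k) 𝓘(ℝ, ℝ) c' (hpr.fibreCoord hσ) := by
  intro m₀
  obtain ⟨A, χ, hA, heA, hsrc, -, -, h2, hχ, -⟩ := hpr.locally_trivial (pr m₀)
  have hprc : ContMDiff (𝓡 k) (𝓡 l) c' pr := hpr.contMDiff_proj.of_le hc
  have hχ2 : ∀ m ∈ pr ⁻¹' A, ContMDiffAt (𝓡 k) 𝓘(ℝ, ℝ) c' (fun m ↦ (χ m).2) m := by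
    intro m hm
    rw [← hsrc] at hm
    exact contMDiffAt_snd.comp m (((hχ m hm).contMDiffAt (χ.open_source.mem_nhds hm)).of_le hc)
  have hs : σ (pr m₀) ∈ pr ⁻¹' A := by rw [mem_preimage, hσ]; exact heA
  have h3 : ContMDiffAt (𝓡 k) 𝓘(ℝ, ℝ) c' (fun m ↦ (χ (σ (pr m))).2) m₀ :=
    ContMDiffAt.comp (g := fun m ↦ (χ m).2) (f := fun m ↦ σ (pr m)) m₀ (hχ2 _ hs)
      ((hσc.comp hprc) m₀)
  refine ((hχ2 m₀ heA).sub h3).congr_of_eventuallyEq ?_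
  filter_upwards [hprc.continuous.continuousAt.eventually (hA.mem_nhds heA)] with m hm
  have hm' : σ (pr m) ∈ pr ⁻¹' A := by rw [mem_preimage, hσ]; exact hm
  have h4 := h2 (hpr.fibreCoord hσ m) _ hm'
  rw [hpr.fibreCoord_vadd] at h4
  change _ = (χ m).2 - (χ (σ (pr m))).2
  rw [h4, add_sub_cancel_right]

theorem mdifferentiable_translation (hpr : IsPrincipalLineBundle (k := k) (l := l) c pr) (hc : c ≠ 0) (s : ℝ) :
    MDifferentiable (𝓡 k) (𝓡 k) (fun x : M ↦ s +ᵥ x) :=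
  (contMDiff_translation hpr.contMDiff_action s).mdifferentiable hc

theorem mfderiv_proj_translation (hpr : IsPrincipalLineBundle (k := k) (l := l) c pr) (hc : c ≠ 0) (s : ℝ) (m : M)
    (X : TangentSpace (𝓡 k) m) :
    (mfderiv (𝓡 k) (𝓡 l) pr (s +ᵥ m) (mfderiv (𝓡 k) (𝓡 k) (fun x : M ↦ s +ᵥ x) m X) :
      EuclideanSpace ℝ (Fin l)) = mfderiv (𝓡 k) (𝓡 l) pr m X := by
  have h : pr ∘ (fun x : M ↦ s +ᵥ x) = pr := by
    funext x
    exact hpr.invariant s x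
  have h2 := DFunLike.congr_fun (mfderiv_comp m (hpr.contMDiff_proj.mdifferentiable hc (s +ᵥ m))
    (hpr.mdifferentiable_translation hc s m)) X
  have h3 : (mfderiv (𝓡 k) (𝓡 l) (pr ∘ (fun x : M ↦ s +ᵥ x)) m X : EuclideanSpace ℝ (Fin l)) =
      mfderiv (𝓡 k) (𝓡 l) pr m X := by rw [h]
  exact h2.symm.trans h3

theorem mfderiv_proj_section (hpr : IsPrincipalLineBundle (k := k) (l := l) c pr) (hc : c ≠ 0)
    (hσ : ∀ e, pr (σ e) = e) (hσd : MDifferentiable (𝓡 l) (𝓡 k) σ) (e : E)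
    (u : TangentSpace (𝓡 l) e) :
    (mfderiv (𝓡 k) (𝓡 l) pr (σ e) (mfderiv (𝓡 l) (𝓡 k) σ e u) : EuclideanSpace ℝ (Fin l)) =
      u := by
  have h : pr ∘ σ = id := by
    funext x
    exact hσ x
  have h2 := DFunLike.congr_fun (mfderiv_comp e (hpr.contMDiff_proj.mdifferentiable hc (σ e))
    (hσd e)) u
  have h3 : (mfderiv (𝓡 l) (𝓡 l) (pr ∘ σ) e u : EuclideanSpace ℝ (Fin l)) = u := by
    rw [h]
    exact DFunLike.congr_fun mfderiv_id u
  exact h2.symm.trans h3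

/-- At points of the section `σ_*` is a right inverse; translations carry it along the fibres. -/
theorem mfderiv_proj_surjective (hpr : IsPrincipalLineBundle (k := k) (l := l) c pr) (hc : c ≠ 0)
    (hσ : ∀ e, pr (σ e) = e) (hσd : MDifferentiable (𝓡 l) (𝓡 k) σ) (m : M) :
    Function.Surjective (mfderiv (𝓡 k) (𝓡 l) pr m) := by
  rw [← hpr.fibreCoord_vadd hσ m]
  intro u
  refine ⟨mfderiv (𝓡 k) (𝓡 k) (fun x : M ↦ hpr.fibreCoord hσ m +ᵥ x) (σ (pr m))
    (mfderiv (𝓡 l) (𝓡 k) σ (pr m) u), ?_⟩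
  exact (hpr.mfderiv_proj_translation hc _ _ _).trans (hpr.mfderiv_proj_section hc hσ hσd (pr m) u)

variable {n : VField k M}

theorem mfderiv_proj_generator (hpr : IsPrincipalLineBundle (k := k) (l := l) c pr) (hc : c ≠ 0)
    (hflow : ∀ m : M, IsMIntegralCurve (I := 𝓡 k) (fun s : ℝ ↦ s +ᵥ m) n) (m : M) :
    mfderiv (𝓡 k) (𝓡 l) pr m (n m) = 0 := by
  suffices h : mfderiv (𝓡 k) (𝓡 l) pr ((0 : ℝ) +ᵥ m) (n ((0 : ℝ) +ᵥ m)) = 0 by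
    rwa [zero_vadd] at h
  have h1 := ((hpr.contMDiff_proj.mdifferentiable hc) ((0 : ℝ) +ᵥ m)).hasMFDerivAt.comp
    (0 : ℝ) (hflow m 0)
  have h2 : pr ∘ (fun r : ℝ ↦ r +ᵥ m) = fun _ ↦ pr m := by
    funext r
    exact hpr.invariant r m
  rw [h2] at h1
  have h3 := DFunLike.congr_fun (hasMFDerivAt_unique h1 (hasMFDerivAt_const (pr m) (0 : ℝ))) (1 : ℝ)
  have h4 : mfderiv (𝓡 k) (𝓡 l) pr ((0 : ℝ) +ᵥ m) ((1 : ℝ) • n ((0 : ℝ) +ᵥ m)) = 0 := h3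
  rwa [one_smul] at h4

end IsPrincipalLineBundle

/-- Rank-nullity. It serves for both projections: the kernel of `π_*` is spanned by `n`, that of
`p_*` by `w`. -/
theorem exists_eq_smul_of_finrank_succ {k l : ℕ} (hk : k = l + 1)
    {A : EuclideanSpace ℝ (Fin k) →L[ℝ] EuclideanSpace ℝ (Fin l)} (hA : Function.Surjective A)
    {n : EuclideanSpace ℝ (Fin k)} (hn : n ≠ 0) (hAn : A n = 0)
    {X : EuclideanSpace ℝ (Fin k)} (hX : A X = 0) : ∃ a : ℝ, X = a • n := by
  let L : EuclideanSpace ℝ (Fin k) →ₗ[ℝ] EuclideanSpace ℝ (Fin l) := A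
  have h1 := L.finrank_range_add_finrank_ker
  rw [LinearMap.range_eq_top.2 hA, finrank_top, finrank_euclideanSpace_fin,
    finrank_euclideanSpace_fin] at h1
  have h2 : Module.finrank ℝ (LinearMap.ker L) = 1 := by omega
  have hn' : (⟨n, hAn⟩ : LinearMap.ker L) ≠ 0 := fun h ↦ hn (congrArg Subtype.val h)
  obtain ⟨a, ha⟩ := (finrank_eq_one_iff_of_nonzero' _ hn').1 h2 ⟨X, hX⟩
  exact ⟨a, (congrArg Subtype.val ha).symm⟩

/-! ### The Newtonian frame of a family of connections -/

section Frame

variable {d : ℕ} {M : Type*} [TopologicalSpace M]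
  [ChartedSpace (EuclideanSpace ℝ (Fin (d + 2))) M]
  {E : Type*} [TopologicalSpace E] [ChartedSpace (EuclideanSpace ℝ (Fin (d + 1))) E]
  {c : ℕ∞ω} {g : BilinField (d + 2) M} {Θ n : VField (d + 2) M} {pr : M → E} {t ψ : M → ℝ}
  {om : ∀ m : M, kerN g n m →ₗ[ℝ] ℝ} {σ : E → M}

theorem onBase_proj [AddAction ℝ M] {f : M → ℝ}
    (hpr : IsPrincipalLineBundle (k := d + 2) (l := d + 1) c pr)
    (hf : ∀ (s : ℝ) (m : M), f (s +ᵥ m) = f m) (m : M) : onBase pr f (pr m) = f m :=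
  have h : Function.FactorsThrough f pr := fun a b hab ↦ by
    obtain ⟨s, rfl⟩ := hpr.exists_vadd_eq hab
    exact (hf s a).symm
  h.extend_apply 0 m

theorem onBase_eq_comp_section [AddAction ℝ M] {f : M → ℝ}
    (hpr : IsPrincipalLineBundle (k := d + 2) (l := d + 1) c pr)
    (hf : ∀ (s : ℝ) (m : M), f (s +ᵥ m) = f m) (hσ : ∀ e, pr (σ e) = e) :
    onBase pr f = f ∘ σ := by
  funext e
  conv_lhs => rw [← hσ e]
  exact onBase_proj hpr hf (σ e)

theorem dReal_onBase [AddAction ℝ M] {f : M → ℝ}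
    (hpr : IsPrincipalLineBundle (k := d + 2) (l := d + 1) c pr) (hc : c ≠ 0)
    (hf : ∀ (s : ℝ) (m : M), f (s +ᵥ m) = f m) (m : M)
    (hfd : MDifferentiableAt (𝓡 (d + 1)) 𝓘(ℝ, ℝ) (onBase pr f) (pr m))
    (X : TangentSpace (𝓡 (d + 2)) m) :
    dReal (onBase pr f) (pr m) (mfderiv (𝓡 (d + 2)) (𝓡 (d + 1)) pr m X) = dReal f m X := by
  have h : onBase pr f ∘ pr = f := funext (onBase_proj hpr hf)
  have h2 := DFunLike.congr_fun
    (mfderiv_comp m hfd (hpr.contMDiff_proj.mdifferentiable hc m)) X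
  rw [h] at h2
  exact h2.symm

/-- A vector `V` represents the connection `om` at `m`: `om = -g(·, V)` on `ker n`. -/
def Represents (g : BilinField (d + 2) M) (n : VField (d + 2) M)
    (om : ∀ m : M, kerN g n m →ₗ[ℝ] ℝ) (m : M) (V : TangentSpace (𝓡 (d + 2)) m) : Prop :=
  ∀ X : kerN g n m, om m X = -(g m X V)

variable (hg : ∀ x, IsLorentzForm (fun X Y : TangentSpace (𝓡 (d + 2)) x ↦ g x X Y))

include hg

theorem isInvertible_metric (m : M) : (g m).IsInvertible :=
  IsLorentzForm.isInvertible (V := EuclideanSpace ℝ (Fin (d + 2))) (B := g m) (hg m)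

/-- Raises the index point by point; as `g` is invertible, the smoothness of `V` follows later from
that of `θ`. -/
theorem exists_vector_of_form (θ : ∀ m : M, TangentSpace (𝓡 (d + 2)) m →L[ℝ] ℝ) :
    ∃ V : VField (d + 2) M, ∀ m, g m (V m) = θ m := by
  have (m : M) : ∃ v, g m v = θ m := by
    obtain ⟨Q, hQ⟩ := isInvertible_metric hg m
    exact ⟨Q.symm (θ m), by rw [← hQ]; exact Q.apply_symm_apply (θ m)⟩
  exact ⟨fun m ↦ (this m).choose, fun m ↦ (this m).choose_spec⟩

theorem represents_of_form {m : M} {θ : TangentSpace (𝓡 (d + 2)) m →L[ℝ] ℝ}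
    (hθ : ∀ X : kerN g n m, om m X = θ X) {V : TangentSpace (𝓡 (d + 2)) m}
    (hV : g m V = θ) : Represents g n om m (-V) := by
  intro X
  rw [hθ, ← hV, map_neg, neg_neg]
  exact (hg m).symm _ _

theorem exists_represents [AddAction ℝ M] [IsManifold (𝓡 (d + 2)) 1 M]
    (hom : IsConnectionFamily c g n om) (m : M) :
    ∃ V, Represents g n om m V := by
  obtain ⟨O, θ, -, hm, -, hθ⟩ := hom.contMDiff m
  obtain ⟨V, hV⟩ := exists_vector_of_form hg θ
  exact ⟨_, represents_of_form hg (hθ m hm) (hV m)⟩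

/-- The difference is orthogonal to the hyperplane `ker n`. -/
theorem Represents.exists_eq_add_smul {m : M} {V V' : TangentSpace (𝓡 (d + 2)) m}
    (hV : Represents g n om m V) (hV' : Represents g n om m V') :
    ∃ a : ℝ, V - V' = a • n m := by
  refine (hg m).eq_smul_of_forall_ker fun X hX ↦ ?_
  have h : -(g m X V) = -(g m X V') := (hV ⟨X, hX⟩).symm.trans (hV' ⟨X, hX⟩)
  have h1 : g m (V - V') X = g m X (V - V') := (hg m).symm _ _
  rw [h1, map_sub, neg_inj.1 h, sub_self]

theorem Represents.add_smul {m : M} {V : TangentSpace (𝓡 (d + 2)) m}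
    (hV : Represents g n om m V) (a : ℝ) : Represents g n om m (V + a • n m) := by
  intro X
  have hX : g m X (n m) = 0 := ((hg m).symm _ _).trans X.2
  rw [hV X, map_add, map_smul, hX, smul_zero, add_zero]

theorem Represents.translate [AddAction ℝ M] [IsManifold (𝓡 (d + 2)) 1 M]
    (hom : IsConnectionFamily c g n om)
    (hn : IsLightlikeKilling g Θ n)
    (hd : ∀ s : ℝ, MDifferentiable (𝓡 (d + 2)) (𝓡 (d + 2)) (fun x : M ↦ s +ᵥ x))
    {m : M} {V : TangentSpace (𝓡 (d + 2)) m} (hV : Represents g n om m V) (s : ℝ) :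
    Represents g n om (s +ᵥ m)
      (mfderiv (𝓡 (d + 2)) (𝓡 (d + 2)) (fun x : M ↦ s +ᵥ x) m V) := by
  rintro ⟨X, hX⟩
  let L : EuclideanSpace ℝ (Fin (d + 2)) →ₗ[ℝ] EuclideanSpace ℝ (Fin (d + 2)) :=
    (mfderiv (𝓡 (d + 2)) (𝓡 (d + 2)) (fun x : M ↦ s +ᵥ x) m).toLinearMap
  -- The differential of a translation is an isometry, hence bijective, so every test vector in `ker
  -- n` at `s +ᵥ m` comes from one at `m`.
  have hinj : Function.Injective L := by
    rw [injective_iff_map_eq_zero]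
    intro Y hY
    refine (hg m).eq_zero_of_forall fun Z ↦ ?_
    have hY' : mfderiv (𝓡 (d + 2)) (𝓡 (d + 2)) (fun x : M ↦ s +ᵥ x) m Y = 0 := hY
    have := hn.metric_invariant hd s m Y Z
    rw [hY', map_zero] at this
    exact this.symm
  obtain ⟨Y, hY⟩ := LinearMap.injective_iff_surjective.1 hinj X
  have hY' : mfderiv (𝓡 (d + 2)) (𝓡 (d + 2)) (fun x : M ↦ s +ᵥ x) m Y = X := hY
  subst hY'
  have hYk : (Y : TangentSpace (𝓡 (d + 2)) m) ∈ kerN g n m := by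
    have h := hn.metric_invariant hd s m (n m) Y
    rw [mfderiv_translation_generator hd hn.flow] at h
    exact h.symm.trans hX
  have h1 := hom.invariant hn hd s m ⟨Y, hYk⟩
  rw [hV] at h1
  exact h1.trans (congrArg Neg.neg (hn.metric_invariant hd s m Y V).symm)

theorem Represents.mfderiv_proj_eq [AddAction ℝ M]
    (hpr : IsPrincipalLineBundle (k := d + 2) (l := d + 1) c pr) (hc : c ≠ 0)
    (hn : IsLightlikeKilling g Θ n) {m : M} {V V' : TangentSpace (𝓡 (d + 2)) m}
    (hV : Represents g n om m V) (hV' : Represents g n om m V') :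
    mfderiv (𝓡 (d + 2)) (𝓡 (d + 1)) pr m V = mfderiv (𝓡 (d + 2)) (𝓡 (d + 1)) pr m V' := by
  obtain ⟨a, ha⟩ := hV.exists_eq_add_smul hg hV'
  rw [← sub_eq_zero, ← map_sub, ha, map_smul, hpr.mfderiv_proj_generator hc hn.flow, smul_zero]

/-- The frame is read off along `σ`; translating a representative shows that every other point of
the fibre gives the same vector. -/
theorem exists_frame [AddAction ℝ M] [IsManifold (𝓡 (d + 2)) 1 M]
    (hpr : IsPrincipalLineBundle (k := d + 2) (l := d + 1) c pr) (hc : c ≠ 0)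
    (hn : IsLightlikeKilling g Θ n) {c' : ℕ∞ω} (hom : IsConnectionFamily c' g n om)
    (hσ : ∀ e, pr (σ e) = e) :
    ∃ w : VField (d + 1) E, ∀ (m : M) (V : TangentSpace (𝓡 (d + 2)) m),
      Represents g n om m V → mfderiv (𝓡 (d + 2)) (𝓡 (d + 1)) pr m V = w (pr m) := by
  choose V hV using exists_represents hg hom
  let w : VField (d + 1) E := fun e ↦
    (mfderiv (𝓡 (d + 2)) (𝓡 (d + 1)) pr (σ e) (V (σ e)) : EuclideanSpace ℝ (Fin (d + 1)))
  have key : ∀ (e : E) (s : ℝ) (m : M), s +ᵥ σ e = m →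
      ∀ V' : TangentSpace (𝓡 (d + 2)) m, Represents g n om m V' →
      (mfderiv (𝓡 (d + 2)) (𝓡 (d + 1)) pr m V' : EuclideanSpace ℝ (Fin (d + 1))) = w e := by
    rintro e s _ rfl V' hV'
    have h1 := (hV (σ e)).translate hg hom hn (hpr.mdifferentiable_translation hc) s
    exact (hV'.mfderiv_proj_eq hg hpr hc hn h1).trans (hpr.mfderiv_proj_translation hc s _ _)
  exact ⟨w, fun m V' hV' ↦ key (pr m) _ m (hpr.fibreCoord_vadd hσ m) V' hV'⟩

/-- Locally `w = π_*(-V ∘ σ)`, where `V` is obtained from a smooth local extension of `ω` by raising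
the index. -/
theorem contMDiff_frame [AddAction ℝ M] [IsManifold (𝓡 (d + 2)) 1 M] [IsManifold (𝓡 (d + 1)) 1 E]
    {c' : ℕ∞ω}
    (hgc : ContMDiff (𝓡 (d + 2)) ((𝓡 (d + 2)).prod 𝓘(ℝ, EuclideanSpace ℝ (Fin (d + 2)) →L[ℝ]
        EuclideanSpace ℝ (Fin (d + 2)) →L[ℝ] ℝ)) c'
      (fun x : M ↦ TotalSpace.mk'
        (EuclideanSpace ℝ (Fin (d + 2)) →L[ℝ] EuclideanSpace ℝ (Fin (d + 2)) →L[ℝ] ℝ)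
        (E := fun x : M ↦ TangentSpace (𝓡 (d + 2)) x →L[ℝ] TangentSpace (𝓡 (d + 2)) x →L[ℝ] ℝ)
        x (g x)))
    (hpr : ContMDiff (𝓡 (d + 2)) (𝓡 (d + 1)) (c' + 1) pr) (hom : IsConnectionFamily c' g n om)
    (hσ : ∀ e, pr (σ e) = e) (hσc : ContMDiff (𝓡 (d + 1)) (𝓡 (d + 2)) c' σ)
    {w : VField (d + 1) E} (hw : ∀ (m : M) (V : TangentSpace (𝓡 (d + 2)) m),
      Represents g n om m V → mfderiv (𝓡 (d + 2)) (𝓡 (d + 1)) pr m V = w (pr m)) :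
    ContMDiff (𝓡 (d + 1)) (𝓡 (d + 1)).tangent c'
      (fun e : E ↦ (⟨e, w e⟩ : TangentBundle (𝓡 (d + 1)) E)) := by
  intro e₀
  obtain ⟨O, θ, hO, hm₀, hθc, hθ⟩ := hom.contMDiff (σ e₀)
  obtain ⟨V, hV⟩ := exists_vector_of_form hg θ
  have hVc : ContMDiffAt (𝓡 (d + 2)) (𝓡 (d + 2)).tangent c'
      (fun m : M ↦ (⟨m, V m⟩ : TangentBundle (𝓡 (d + 2)) M)) (σ e₀) := by
    refine contMDiffAt_of_clm_bundle_apply (b := fun m : M ↦ m)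
      (E₁ := fun y : M ↦ TangentSpace (𝓡 (d + 2)) y)
      (E₂ := fun y : M ↦ TangentSpace (𝓡 (d + 2)) y →L[ℝ] ℝ)
      (ϕ := g) (hgc (σ e₀)) (isInvertible_metric hg) ?_
    refine (hθc.contMDiffAt (hO.mem_nhds hm₀)).congr_of_eventuallyEq
      (Filter.Eventually.of_forall fun m ↦ ?_)
    simp only [hV]
  have hVn : ContMDiffAt (𝓡 (d + 2)) (𝓡 (d + 2)).tangent c'
      (fun m : M ↦ (⟨m, -V m⟩ : TangentBundle (𝓡 (d + 2)) M)) (σ e₀) := hVc.neg_section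
  have hT := (hpr.contMDiff_tangentMap (m := c') le_rfl).contMDiffAt.comp e₀
    (ContMDiffAt.comp e₀ hVn (hσc e₀))
  refine hT.congr_of_eventuallyEq ?_
  filter_upwards [hσc.continuous.continuousAt.eventually (hO.mem_nhds hm₀)] with e he
  have h := hw (σ e) _ (represents_of_form hg (hθ _ he) (hV _))
  have hcongr : ∀ {x y : E} (_ : x = y) (u : TangentSpace (𝓡 (d + 1)) x)
      (v : TangentSpace (𝓡 (d + 1)) y) (_ : (u : EuclideanSpace ℝ (Fin (d + 1))) = v),
      (⟨x, u⟩ : TangentBundle (𝓡 (d + 1)) E) = ⟨y, v⟩ := by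
    rintro x _ rfl u _ rfl
    rfl
  exact hcongr (hσ e).symm _ _ ((vfield_congr w (hσ e).symm).trans h.symm)

/-- Two vectors over `w` differ by a multiple of `n`, which is invisible to `g(X, ·)` for `X` in
`ker n`. -/
theorem isAssociated_of_represents [AddAction ℝ M] [IsManifold (𝓡 (d + 2)) 1 M]
    (hpr : IsPrincipalLineBundle (k := d + 2) (l := d + 1) c pr) (hc : c ≠ 0)
    (hn : IsLightlikeKilling g Θ n) {c' : ℕ∞ω} (hom : IsConnectionFamily c' g n om)
    (hσ : ∀ e, pr (σ e) = e) (hσd : MDifferentiable (𝓡 (d + 1)) (𝓡 (d + 2)) σ)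
    {w : VField (d + 1) E} (hw : ∀ (m : M) (V : TangentSpace (𝓡 (d + 2)) m),
      Represents g n om m V → mfderiv (𝓡 (d + 2)) (𝓡 (d + 1)) pr m V = w (pr m)) :
    IsAssociated g n pr om w := by
  intro m V hV
  obtain ⟨V', hV'⟩ := exists_represents hg hom m
  obtain ⟨a, ha⟩ := exists_eq_smul_of_finrank_succ (l := d + 1) (k := d + 2) rfl
    (hpr.mfderiv_proj_surjective hc hσ hσd m) (hn.ne_zero m)
    (hpr.mfderiv_proj_generator hc hn.flow m) (X := V - V')
    (by
      have : mfderiv (𝓡 (d + 2)) (𝓡 (d + 1)) pr m (V - V') = 0 := by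
        rw [map_sub, hV, hw m V' hV', sub_self]
      exact this)
  have hVV : V = V' + a • n m := by
    have h : V - V' = a • n m := ha
    rw [← h, add_sub_cancel]
  rw [hVV]
  exact hV'.add_smul hg a

omit hg

/-- Uniqueness: any lift of `w'` represents `ω`, so it projects to `w`. -/
theorem represents_eq_of_isAssociated [AddAction ℝ M]
    (hpr : IsPrincipalLineBundle (k := d + 2) (l := d + 1) c pr) (hc : c ≠ 0)
    (hσ : ∀ e, pr (σ e) = e) (hσd : MDifferentiable (𝓡 (d + 1)) (𝓡 (d + 2)) σ)
    {w w' : VField (d + 1) E} (hw : ∀ (m : M) (V : TangentSpace (𝓡 (d + 2)) m),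
      Represents g n om m V → mfderiv (𝓡 (d + 2)) (𝓡 (d + 1)) pr m V = w (pr m))
    (hw' : IsAssociated g n pr om w') : w' = w := by
  funext e
  suffices h : ∀ m, w' (pr m) = w (pr m) from hσ e ▸ h (σ e)
  intro m
  obtain ⟨V, hV⟩ := hpr.mfderiv_proj_surjective hc hσ hσd m (w' (pr m))
  rw [← hV]
  exact hw m V (hw' m V hV)

/-- The normalization `ψ dt(V) = 1` of the vectors representing a connection. -/
theorem Represents.normalized [AddAction ℝ M] [IsManifold (𝓡 (d + 2)) 1 M] {c' c'' : ℕ∞ω}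
    (hn : IsLightlikeKilling g Θ n) (ht : IsGloballyIntegrable c'' g n t ψ)
    (hom : IsConnectionFamily c' g n om) {m : M} {V : TangentSpace (𝓡 (d + 2)) m}
    (hV : Represents g n om m V) : ψ m * dReal t m V = 1 := by
  have h := hV ⟨n m, hn.lightlike m⟩
  rw [hom.unit m (hn.lightlike m)] at h
  have h2 := ht.n_eq m V
  have h3 : (1 : ℝ) = -(g m (n m) V) := h
  rw [h3, h2, neg_neg]

/-- Existence and uniqueness of the Newtonian frame associated with a family of connections. -/
theorem existsUnique_frame [AddAction ℝ M] [IsManifold (𝓡 (d + 2)) 1 M]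
    [IsManifold (𝓡 (d + 1)) 1 E] {c' : ℕ∞ω} (hc' : c' ≠ 0) (hg : IsSpacetime c' g Θ)
    (hn : IsLightlikeKilling g Θ n)
    (hpr : IsPrincipalLineBundle (k := d + 2) (l := d + 1) (c' + 1) pr)
    (ht : IsGloballyIntegrable c' g n t ψ) (hom : IsConnectionFamily c' g n om)
    (hσc : ContMDiff (𝓡 (d + 1)) (𝓡 (d + 2)) c' σ) (hσ : ∀ e, pr (σ e) = e) :
    ∃! w : VField (d + 1) E,
      IsNewtonianFrame c' (onBase pr t) (onBase pr ψ) w ∧ IsAssociated g n pr om w := by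
  have hc : c' + 1 ≠ 0 := by simp
  have hσd := hσc.mdifferentiable hc'
  have hd := hpr.mdifferentiable_translation hc
  obtain ⟨w, hw⟩ := exists_frame hg.lorentz hpr hc hn hom hσ
  have htE : ContMDiff (𝓡 (d + 1)) 𝓘(ℝ, ℝ) c' (onBase pr t) := by
    rw [onBase_eq_comp_section hpr (ht.t_invariant hn) hσ]
    exact (ht.contMDiff_t.of_le (self_le_add_right _ _)).comp hσc
  refine ⟨w, ⟨⟨contMDiff_frame hg.lorentz hg.contMDiff hpr.contMDiff_proj hom hσ hσc hw, ?_⟩,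
    isAssociated_of_represents hg.lorentz hpr hc hn hom hσ hσd hw⟩,
    fun w' hw' ↦ represents_eq_of_isAssociated hpr hc hσ hσd hw hw'.2⟩
  suffices h : ∀ m, onBase pr ψ (pr m) * dReal (onBase pr t) (pr m) (w (pr m)) = 1 from
    fun e ↦ hσ e ▸ h (σ e)
  intro m
  obtain ⟨V, hV⟩ := exists_represents hg.lorentz hom m
  rw [← hw m V hV, onBase_proj hpr (ht.ψ_invariant hn hg.lorentz hd),
    dReal_onBase hpr hc (ht.t_invariant hn) m ((htE.mdifferentiable hc') _)]
  exact hV.normalized hn ht hom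

end Frame

/-! ### The base as the product of time and space -/

section SpaceOfFrame

variable {d : ℕ} {c : ℕ∞ω}
  {E : Type*} [TopologicalSpace E] [ChartedSpace (EuclideanSpace ℝ (Fin (d + 1))) E]
  {S : Type*} [TopologicalSpace S] [ChartedSpace (EuclideanSpace ℝ (Fin d)) S]
  {t : E → ℝ} {w : VField (d + 1) E} {p : E → S}

theorem hasDerivAt_comp_integralCurve (ht : MDifferentiable (𝓡 (d + 1)) 𝓘(ℝ, ℝ) t)
    {γ : ℝ → E} {J : Set ℝ} (hJ : IsOpen J) (hγ : IsMIntegralCurveOn (I := 𝓡 (d + 1)) γ w J)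
    {s : ℝ} (hs : s ∈ J) : HasDerivAt (t ∘ γ) (dReal t (γ s) (w (γ s))) s := by
  let L : ℝ →L[ℝ] ℝ := (mfderiv (𝓡 (d + 1)) 𝓘(ℝ, ℝ) t (γ s)).comp
    ((1 : ℝ →L[ℝ] ℝ).smulRight (w (γ s)))
  have h : HasFDerivAt (t ∘ γ) L s :=
    ((ht (γ s)).hasMFDerivAt.comp s ((hγ s hs).hasMFDerivAt (hJ.mem_nhds hs))).hasFDerivAt
  refine h.hasDerivAt.congr_deriv ?_
  change mfderiv (𝓡 (d + 1)) 𝓘(ℝ, ℝ) t (γ s) ((1 : ℝ) • w (γ s)) = _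
  rw [one_smul]
  rfl

/-- Reflexivity in `fibres` already supplies an integral curve through `e`; no existence theorem for
differential equations is needed. -/
theorem IsSpaceOfFrame.exists_integralCurve (hp : IsSpaceOfFrame (d := d) c t w p) (e : E) :
    ∃ (γ : ℝ → E) (J : Set ℝ) (s : ℝ), IsOpen J ∧ J.OrdConnected ∧
      IsMIntegralCurveOn (I := 𝓡 (d + 1)) γ w J ∧ s ∈ J ∧ γ s = e := by
  obtain ⟨γ, J, hJ, hJc, hγ, ⟨s, hs, hse⟩, -⟩ := (hp.fibres e e).1 rfl
  exact ⟨γ, J, s, hJ, hJc, hγ, hs, hse⟩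

/-- The frame is tangent to the fibres of the projection on its space. -/
theorem IsSpaceOfFrame.mfderiv_frame (hp : IsSpaceOfFrame (d := d) c t w p) (hc : c ≠ 0) (e : E) :
    mfderiv (𝓡 (d + 1)) (𝓡 d) p e (w e) = 0 := by
  obtain ⟨γ, J, s, hJ, hJc, hγ, hs, rfl⟩ := hp.exists_integralCurve e
  have h1 := (hp.contMDiff.mdifferentiable hc (γ s)).hasMFDerivAt.comp s
    ((hγ s hs).hasMFDerivAt (hJ.mem_nhds hs))
  have h2 : HasMFDerivAt 𝓘(ℝ, ℝ) (𝓡 d) (p ∘ γ) s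
      (0 : TangentSpace 𝓘(ℝ, ℝ) s →L[ℝ] TangentSpace (𝓡 d) (p (γ s))) := by
    refine (hasMFDerivAt_const (p (γ s)) s).congr_of_eventuallyEq ?_
    filter_upwards [hJ.mem_nhds hs] with u hu
    exact (hp.fibres _ _).2 ⟨γ, J, hJ, hJc, hγ, mem_image_of_mem γ hu, mem_image_of_mem γ hs⟩
  have h3 := DFunLike.congr_fun (hasMFDerivAt_unique h1 h2) (1 : ℝ)
  have h4 : mfderiv (𝓡 (d + 1)) (𝓡 d) p (γ s) ((1 : ℝ) • w (γ s)) = 0 := h3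
  rwa [one_smul] at h4

/-- Along an integral line `t` is strictly increasing, so the line meets a slice at most once. -/
theorem IsSpaceOfFrame.injective (hp : IsSpaceOfFrame (d := d) c t w p)
    (ht : MDifferentiable (𝓡 (d + 1)) 𝓘(ℝ, ℝ) t) (hw : ∀ e, 0 < dReal t e (w e)) {e e' : E}
    (htt : t e = t e') (hpp : p e = p e') : e = e' := by
  obtain ⟨γ, J, hJ, hJc, hγ, ⟨s, hs, rfl⟩, ⟨s', hs', rfl⟩⟩ := (hp.fibres e e').1 hpp
  have hmono : StrictMonoOn (t ∘ γ) J := by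
    refine strictMonoOn_of_deriv_pos hJc.convex (fun u hu ↦
      (hasDerivAt_comp_integralCurve ht hJ hγ hu).continuousAt.continuousWithinAt) fun u hu ↦ ?_
    rw [hJ.interior_eq] at hu
    rw [(hasDerivAt_comp_integralCurve ht hJ hγ hu).deriv]
    exact hw _
  rw [hmono.injOn hs hs' htt]

/-- The positive derivative along the frame excludes extrema of `t`, so each value lies strictly
between two others, and the range is an interval. -/
theorem IsSpaceOfFrame.isOpen_range [PreconnectedSpace E] (hp : IsSpaceOfFrame (d := d) c t w p)
    (ht : MDifferentiable (𝓡 (d + 1)) 𝓘(ℝ, ℝ) t) (hw : ∀ e, 0 < dReal t e (w e)) :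
    IsOpen (range t) := by
  rw [isOpen_iff_mem_nhds]
  rintro _ ⟨e, rfl⟩
  obtain ⟨γ, J, s, hJ, -, hγ, hs, rfl⟩ := hp.exists_integralCurve e
  have hder := hasDerivAt_comp_integralCurve ht hJ hγ hs
  obtain ⟨e₁, h₁⟩ : ∃ e₁, t e₁ < t (γ s) := by
    by_contra! h
    have hmin : IsLocalMin (t ∘ γ) s := Filter.Eventually.of_forall fun u ↦ h _
    exact (hw _).ne' (hmin.hasDerivAt_eq_zero hder)
  obtain ⟨e₂, h₂⟩ : ∃ e₂, t (γ s) < t e₂ := by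
    by_contra! h
    have hmax : IsLocalMax (t ∘ γ) s := Filter.Eventually.of_forall fun u ↦ h _
    exact (hw _).ne' (hmax.hasDerivAt_eq_zero hder)
  have hconn : (range t).OrdConnected :=
    (isPreconnected_range ht.continuous).ordConnected
  exact Filter.mem_of_superset (Icc_mem_nhds h₁ h₂) (hconn.out ⟨e₁, rfl⟩ ⟨e₂, rfl⟩)

variable {T : TopologicalSpace.Opens ℝ}

theorem mfderiv_timeSpace {F : E → T × S} (ht : MDifferentiable (𝓡 (d + 1)) 𝓘(ℝ, ℝ) t)
    (hF : MDifferentiable (𝓡 (d + 1)) (𝓘(ℝ, ℝ).prod (𝓡 d)) F)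
    (hF1 : ∀ e, ((F e).1 : ℝ) = t e) (hF2 : ∀ e, (F e).2 = p e) (e : E)
    (u : TangentSpace (𝓡 (d + 1)) e) :
    (mfderiv (𝓡 (d + 1)) (𝓘(ℝ, ℝ).prod (𝓡 d)) F e u : ℝ × EuclideanSpace ℝ (Fin d)) =
      (dReal t e u, mfderiv (𝓡 (d + 1)) (𝓡 d) p e u) := by
  obtain rfl : (fun e ↦ (F e).2) = p := funext hF2
  obtain rfl : (fun e ↦ ((F e).1 : ℝ)) = t := funext hF1
  have h1 : MDifferentiableAt (𝓡 (d + 1)) 𝓘(ℝ, ℝ) (fun e ↦ (F e).1) e := (hF e).fst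
  have h2 : MDifferentiableAt (𝓡 (d + 1)) (𝓡 d) (fun e ↦ (F e).2) e := (hF e).snd
  have h3 := DFunLike.congr_fun (mfderiv_prodMk h1 h2) u
  have h4 := mfderiv_opens_real h1 u
  refine h3.trans ?_
  exact Prod.ext h4 rfl

/-- Time and the projection on the space of the frame identify `E` with `T × S`. -/
theorem IsSpaceOfFrame.exists_diffeomorph [IsManifold (𝓡 (d + 1)) c E] [IsManifold (𝓡 d) c S]
    (hp : IsSpaceOfFrame (d := d) c t w p) (hc : c ≠ 0) (ht : ContMDiff (𝓡 (d + 1)) 𝓘(ℝ, ℝ) c t)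
    (hw : ∀ e, 0 < dReal t e (w e)) (hT : (T : Set ℝ) = range t) :
    ∃ F : Diffeomorph (𝓡 (d + 1)) (𝓘(ℝ, ℝ).prod (𝓡 d)) E (T × S) c,
      (∀ e, ((F e).1 : ℝ) = t e) ∧ ∀ e, (F e).2 = p e := by
  have htd := ht.mdifferentiable hc
  have hmem (e : E) : t e ∈ T := by
    change t e ∈ (T : Set ℝ)
    rw [hT]
    exact mem_range_self e
  let F : E → T × S := fun e ↦ (⟨t e, hmem e⟩, p e)
  have hF : ContMDiff (𝓡 (d + 1)) (𝓘(ℝ, ℝ).prod (𝓡 d)) c F :=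
    (contMDiff_opens_real ht).prodMk hp.contMDiff
  have hbij : Function.Bijective F := by
    refine ⟨fun e e' h ↦ hp.injective htd hw (congrArg (fun x ↦ (x.1 : ℝ)) h)
      (congrArg Prod.snd h), fun ⟨τ, q⟩ ↦ ?_⟩
    obtain ⟨e, rfl, he⟩ := hp.meets_slices q τ (hT ▸ τ.2)
    exact ⟨e, Prod.ext (Subtype.ext he) rfl⟩
  have hd : ∀ e, Function.Bijective (mfderiv (𝓡 (d + 1)) (𝓘(ℝ, ℝ).prod (𝓡 d)) F e) := by
    intro e
    let L : EuclideanSpace ℝ (Fin (d + 1)) →ₗ[ℝ] ℝ × EuclideanSpace ℝ (Fin d) :=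
      (mfderiv (𝓡 (d + 1)) (𝓘(ℝ, ℝ).prod (𝓡 d)) F e).toLinearMap
    -- A vector killed by `dp` is a multiple of `w`, and `dt[w] > 0` forces the multiple to be zero.
    have hinj : Function.Injective L := by
      rw [injective_iff_map_eq_zero]
      intro u hu
      have h := mfderiv_timeSpace htd (hF.mdifferentiable hc) (fun _ ↦ rfl) (fun _ ↦ rfl) e u
      have h0 : (dReal t e u, mfderiv (𝓡 (d + 1)) (𝓡 d) p e u) =
        ((0, 0) : ℝ × EuclideanSpace ℝ (Fin d)) := h.symm.trans hu
      have hwne : w e ≠ 0 := fun h ↦ (hw e).ne' (by rw [h, map_zero])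
      obtain ⟨a, ha⟩ := exists_eq_smul_of_finrank_succ (k := d + 1) (l := d) rfl
        (hp.submersion e) hwne (hp.mfderiv_frame hc e) (X := u) (congrArg Prod.snd h0)
      have h1 : dReal t e (a • w e) = 0 := by
        have : u = a • w e := ha
        rw [← this]
        exact congrArg Prod.fst h0
      rw [map_smul, smul_eq_mul, mul_eq_zero, or_iff_left (hw e).ne'] at h1
      rw [ha, h1]
      exact zero_smul ℝ _
    refine ⟨hinj, ?_⟩
    exact (LinearMap.injective_iff_surjective_of_finrank_eq_finrank (f := L) (by
      simp [add_comm])).1 hinj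
  exact ⟨diffeomorphOfBijective hc (Equiv.ofBijective F hbij) hF hd, fun _ ↦ rfl, fun _ ↦ rfl⟩

end SpaceOfFrame

/-! ### The Eisenhart data of a pulled back metric -/

section Data

variable {d : ℕ} {r : ℕ∞ω} {T : TopologicalSpace.Opens ℝ}
  {M : Type*} [TopologicalSpace M] [ChartedSpace (EuclideanSpace ℝ (Fin (d + 2))) M]
  {S : Type*} [TopologicalSpace S] [ChartedSpace (EuclideanSpace ℝ (Fin d)) S]

/-- The differential of a map defined on `T × S`, at a vector `(τ, v)`. -/
noncomputable def dTS (G : T × S → M) (x : T × S) :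
    ℝ × EuclideanSpace ℝ (Fin d) →L[ℝ] TangentSpace (𝓡 (d + 2)) (G x) :=
  mfderiv (𝓘(ℝ, ℝ).prod (𝓡 d)) (𝓡 (d + 2)) G x

/-- The restriction to the slices of the pull back of `g` by a map defined on `T × S`. -/
noncomputable def sliceMetric (g : BilinField (d + 2) M) (G : T × S → M) (x : T × S) :
    TangentSpace (𝓡 d) x.2 →L[ℝ] TangentSpace (𝓡 d) x.2 →L[ℝ] ℝ :=
  let A : EuclideanSpace ℝ (Fin d) →L[ℝ] EuclideanSpace ℝ (Fin (d + 2)) :=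
    (dTS G x).comp (ContinuousLinearMap.inr ℝ ℝ (EuclideanSpace ℝ (Fin d)))
  let B : EuclideanSpace ℝ (Fin (d + 2)) →L[ℝ] EuclideanSpace ℝ (Fin (d + 2)) →L[ℝ] ℝ := g (G x)
  B.bilinearComp A A

theorem sliceMetric_apply (g : BilinField (d + 2) M) (G : T × S → M) (x : T × S)
    (u v : TangentSpace (𝓡 d) x.2) :
    sliceMetric g G x u v = g (G x) (dTS G x (0, u)) (dTS G x (0, v)) := rfl

/-- The form `u ↦ g(∂/∂t, u) / ψ` on the slices, for the pull back of `g` by a map defined on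
`T × S`. -/
noncomputable def sliceForm (g : BilinField (d + 2) M) (G : T × S → M) (ψ : M → ℝ) (x : T × S) :
    TangentSpace (𝓡 d) x.2 →L[ℝ] ℝ :=
  let A : EuclideanSpace ℝ (Fin d) →L[ℝ] EuclideanSpace ℝ (Fin (d + 2)) :=
    (dTS G x).comp (ContinuousLinearMap.inr ℝ ℝ (EuclideanSpace ℝ (Fin d)))
  let B : EuclideanSpace ℝ (Fin (d + 2)) →L[ℝ] EuclideanSpace ℝ (Fin (d + 2)) →L[ℝ] ℝ := g (G x)
  (ψ (G x))⁻¹ • (B (dTS G x (1, 0))).comp A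

theorem sliceForm_apply (g : BilinField (d + 2) M) (G : T × S → M) (ψ : M → ℝ) (x : T × S)
    (u : TangentSpace (𝓡 d) x.2) :
    sliceForm g G ψ x u = (ψ (G x))⁻¹ * g (G x) (dTS G x (1, 0)) (dTS G x (0, u)) := rfl

/-- The potential obtained from `g(∂/∂t, ∂/∂t)`. -/
noncomputable def slicePotential (g : BilinField (d + 2) M) (G : T × S → M) (ψ : M → ℝ)
    (x : T × S) : ℝ :=
  -- The solution `U` of `-(2U + 1) ψ² = g(∂/∂t, ∂/∂t)`.
  -(1 / 2) * ((ψ (G x))⁻¹ * (ψ (G x))⁻¹ * g (G x) (dTS G x (1, 0)) (dTS G x (1, 0)) + 1)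

/-- The right side is the Eisenhart metric with `n = -ψ dt` and `dy = 0`; `sliceForm` and
`slicePotential` are made to match its mixed and time-time terms. -/
theorem pullback_apply (g : BilinField (d + 2) M) (G : T × S → M) (ψ : M → ℝ) (x : T × S)
    (hs : ∀ X Y, g (G x) X Y = g (G x) Y X) (hψ : ψ (G x) ≠ 0) (a b : ℝ)
    (u v : TangentSpace (𝓡 d) x.2) :
    g (G x) (dTS G x (a, u)) (dTS G x (b, v)) =
      sliceMetric g G x u v + a * ψ (G x) * sliceForm g G ψ x v
        + b * ψ (G x) * sliceForm g G ψ x u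
        - (2 * slicePotential g G ψ x + 1) * (a * b * ψ (G x) ^ 2) := by
  have h (a : ℝ) (u : EuclideanSpace ℝ (Fin d)) :
      dTS G x (a, u) = a • dTS G x (1, 0) + dTS G x (0, u) := by
    rw [← map_smul, ← map_add]
    simp
  rw [h a u, h b v, sliceMetric_apply, sliceForm_apply, sliceForm_apply, slicePotential]
  simp only [map_add, map_smul, _root_.add_apply, _root_.smul_apply, smul_eq_mul]
  rw [hs (dTS G x (0, u)) (dTS G x (1, 0))]
  field_simp
  ring

variable [IsManifold (𝓡 (d + 2)) 1 M] [IsManifold (𝓡 d) 1 S]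

/-- The Eisenhart data obtained by pulling back a metric by a map defined on `T × S`. -/
noncomputable def pullbackData {g : BilinField (d + 2) M} {G : T × S → M} {ψ : M → ℝ}
    (hs : ∀ m X Y, g m X Y = g m Y X) (hψ : ∀ m, 0 < ψ m)
    (hpos : ∀ (x : T × S) (v : TangentSpace (𝓡 d) x.2), v ≠ 0 → 0 < sliceMetric g G x v v)
    (hgc : ContMDiff (𝓡 (d + 2)) ((𝓡 (d + 2)).prod 𝓘(ℝ, EuclideanSpace ℝ (Fin (d + 2)) →L[ℝ]
        EuclideanSpace ℝ (Fin (d + 2)) →L[ℝ] ℝ)) r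
      (fun x : M ↦ TotalSpace.mk'
        (EuclideanSpace ℝ (Fin (d + 2)) →L[ℝ] EuclideanSpace ℝ (Fin (d + 2)) →L[ℝ] ℝ)
        (E := fun x : M ↦ TangentSpace (𝓡 (d + 2)) x →L[ℝ] TangentSpace (𝓡 (d + 2)) x →L[ℝ] ℝ)
        x (g x)))
    (hG : ContMDiff (𝓘(ℝ, ℝ).prod (𝓡 d)) (𝓡 (d + 2)) (r + 1) G)
    (hψc : ContMDiff (𝓡 (d + 2)) 𝓘(ℝ, ℝ) r ψ) : EisenhartData d r T S :=
  have hψG : ContMDiff (𝓘(ℝ, ℝ).prod (𝓡 d)) 𝓘(ℝ, ℝ) r (fun x ↦ ψ (G x)) :=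
    hψc.comp (hG.of_le (self_le_add_right r 1))
  have hψi : ContMDiff (𝓘(ℝ, ℝ).prod (𝓡 d)) 𝓘(ℝ, ℝ) r (fun x ↦ (ψ (G x))⁻¹) :=
    hψG.inv₀ fun x ↦ (hψ _).ne'
  have hdt (x : T × S) : ContMDiffAt (𝓘(ℝ, ℝ).prod (𝓡 d)) (𝓘(ℝ, ℝ).prod (𝓡 d)).tangent r
      (fun x : T × S ↦ (⟨x, ((1 : ℝ), (0 : EuclideanSpace ℝ (Fin d)))⟩ :
        TangentBundle (𝓘(ℝ, ℝ).prod (𝓡 d)) (T × S))) x :=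
    contMDiffAt_prod_section 1 ((contMDiff_zeroSection ℝ
      (fun q : S ↦ TangentSpace (𝓡 d) q)).contMDiffAt.comp x contMDiffAt_snd)
  { a := fun τ q ↦ sliceMetric g G (τ, q)
    b := fun τ q ↦ sliceForm g G ψ (τ, q)
    U := fun τ q ↦ slicePotential g G ψ (τ, q)
    ψ := fun τ q ↦ ψ (G (τ, q))
    a_symm := fun τ q v v' ↦ hs _ _ _
    a_pos := fun τ q v hv ↦ hpos (τ, q) v hv
    ψ_pos := fun τ q ↦ hψ _
    contMDiff_a := fun x ↦ by
      refine contMDiffAt_hom_bundle_of_apply (b := fun x : T × S ↦ x.2)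
        (E₁ := fun q : S ↦ TangentSpace (𝓡 d) q)
        (E₂ := fun q : S ↦ TangentSpace (𝓡 d) q →L[ℝ] ℝ)
        (F₂ := EuclideanSpace ℝ (Fin d) →L[ℝ] ℝ) contMDiffAt_snd fun v hv ↦ ?_
      -- The criterion is used a second time, for the remaining argument of the bilinear form.
      refine contMDiffAt_hom_bundle_of_apply (b := fun x : T × S ↦ x.2)
        (E₁ := fun q : S ↦ TangentSpace (𝓡 d) q) (E₂ := Bundle.Trivial S ℝ) (F₂ := ℝ)
        contMDiffAt_snd fun v' hv' ↦ ?_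
      rw [contMDiffAt_totalSpace]
      exact ⟨contMDiffAt_snd, contMDiffAt_pullback hgc hG (contMDiffAt_prod_section 0 hv)
        (contMDiffAt_prod_section 0 hv')⟩
    contMDiff_b := fun x ↦ by
      refine contMDiffAt_hom_bundle_of_apply (b := fun x : T × S ↦ x.2)
        (E₁ := fun q : S ↦ TangentSpace (𝓡 d) q) (E₂ := Bundle.Trivial S ℝ) (F₂ := ℝ)
        contMDiffAt_snd fun v hv ↦ ?_
      rw [contMDiffAt_totalSpace]
      exact ⟨contMDiffAt_snd, (hψi x).mul
        (contMDiffAt_pullback hgc hG (hdt x) (contMDiffAt_prod_section 0 hv))⟩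
    contMDiff_U := fun x ↦ contMDiffAt_const.mul ((((hψi x).mul (hψi x)).mul
      (contMDiffAt_pullback hgc hG (hdt x) (hdt x))).add contMDiffAt_const)
    contMDiff_ψ := hψG }

end Data

/-! ### Splitting vectors and the metric along the fibres -/

section Decomposition

variable {d : ℕ} {M : Type*} [TopologicalSpace M]
  [ChartedSpace (EuclideanSpace ℝ (Fin (d + 2))) M]
  {E : Type*} [TopologicalSpace E] [ChartedSpace (EuclideanSpace ℝ (Fin (d + 1))) E]
  [AddAction ℝ M] {c c' : ℕ∞ω} {g : BilinField (d + 2) M} {Θ n : VField (d + 2) M} {pr : M → E}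
  {σ : E → M}
  (hpr : IsPrincipalLineBundle (k := d + 2) (l := d + 1) c pr) (hσ : ∀ e, pr (σ e) = e)
  (hfd : MDifferentiable (𝓡 (d + 2)) 𝓘(ℝ, ℝ) (hpr.fibreCoord hσ))

include hfd

theorem dReal_fibreCoord_generator
    (hflow : ∀ m : M, IsMIntegralCurve (I := 𝓡 (d + 2)) (fun s : ℝ ↦ s +ᵥ m) n) (m : M) :
    dReal (hpr.fibreCoord hσ) m (n m) = 1 := by
  suffices h : dReal (hpr.fibreCoord hσ) ((0 : ℝ) +ᵥ m) (n ((0 : ℝ) +ᵥ m)) = 1 by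
    rwa [zero_vadd] at h
  have h1 := hasDerivAt_comp_flow hflow m 0 (hfd ((0 : ℝ) +ᵥ m))
  refine h1.unique ?_
  simp only [hpr.fibreCoord_vadd_add hσ]
  exact (hasDerivAt_id _).add_const _

/-- `X` and the translate of `σ_* u` have the same projection, so they differ by a multiple of `n`.
The coefficient is `dy[X]`: `y` is constant on the translated section, and `dy[n] = 1`. -/
theorem eq_translate_of_proj (hc : c ≠ 0) (hn : IsLightlikeKilling g Θ n)
    (hσd : MDifferentiable (𝓡 (d + 1)) (𝓡 (d + 2)) σ) (e : E) (y : ℝ)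
    (X : TangentSpace (𝓡 (d + 2)) (y +ᵥ σ e)) (u : TangentSpace (𝓡 (d + 1)) e)
    (hu : (mfderiv (𝓡 (d + 2)) (𝓡 (d + 1)) pr (y +ᵥ σ e) X : EuclideanSpace ℝ (Fin (d + 1))) =
      u) :
    X = mfderiv (𝓡 (d + 2)) (𝓡 (d + 2)) (fun x : M ↦ y +ᵥ x) (σ e)
      (mfderiv (𝓡 (d + 1)) (𝓡 (d + 2)) σ e u +
        dReal (hpr.fibreCoord hσ) (y +ᵥ σ e) X • n (σ e)) := by
  have hd := hpr.mdifferentiable_translation hc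
  set Y := mfderiv (𝓡 (d + 2)) (𝓡 (d + 2)) (fun x : M ↦ y +ᵥ x) (σ e)
    (mfderiv (𝓡 (d + 1)) (𝓡 (d + 2)) σ e u) with hY
  have hprY : (mfderiv (𝓡 (d + 2)) (𝓡 (d + 1)) pr (y +ᵥ σ e) Y :
      EuclideanSpace ℝ (Fin (d + 1))) = u :=
    (hpr.mfderiv_proj_translation hc y _ _).trans (hpr.mfderiv_proj_section hc hσ hσd e u)
  have hfY : dReal (hpr.fibreCoord hσ) (y +ᵥ σ e) Y = 0 := by
    have h1 : hpr.fibreCoord hσ ∘ ((fun x : M ↦ y +ᵥ x) ∘ σ) = fun _ ↦ y := by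
      funext e
      exact hpr.fibreCoord_vadd_section hσ y e
    have h2 := (hfd (y +ᵥ σ e)).hasMFDerivAt.comp e
      ((hd y (σ e)).hasMFDerivAt.comp e (hσd e).hasMFDerivAt)
    rw [h1] at h2
    exact DFunLike.congr_fun (hasMFDerivAt_unique h2 (hasMFDerivAt_const y e)) u
  obtain ⟨a, ha⟩ := exists_eq_smul_of_finrank_succ (l := d + 1) (k := d + 2) rfl
    (hpr.mfderiv_proj_surjective hc hσ hσd (y +ᵥ σ e)) (hn.ne_zero (y +ᵥ σ e))
    (hpr.mfderiv_proj_generator hc hn.flow (y +ᵥ σ e)) (X := X - Y)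
    (by
      have : mfderiv (𝓡 (d + 2)) (𝓡 (d + 1)) pr (y +ᵥ σ e) (X - Y) = 0 := by
        rw [map_sub, sub_eq_zero]
        exact hu.trans hprY.symm
      exact this)
  have ha' : X - Y = a • n (y +ᵥ σ e) := ha
  have h3 : dReal (hpr.fibreCoord hσ) (y +ᵥ σ e) (X - Y) = a := by
    rw [ha', map_smul, dReal_fibreCoord_generator hpr hσ hfd hn.flow, smul_eq_mul, mul_one]
  rw [map_sub, hfY, sub_zero] at h3
  rw [map_add, map_smul, ← hY, mfderiv_translation_generator hd hn.flow, h3, ← ha',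
    add_sub_cancel]

/-- Invariance moves the computation to the section, and nullity of `n` removes the `dy ⊗ dy` term.
-/
theorem metric_eq_of_proj (hc : c ≠ 0) (hn : IsLightlikeKilling g Θ n)
    (hs : ∀ m X Y, g m X Y = g m Y X)
    (hσd : MDifferentiable (𝓡 (d + 1)) (𝓡 (d + 2)) σ) {e : E} {y : ℝ} {m : M}
    (hm : y +ᵥ σ e = m) (X X' : TangentSpace (𝓡 (d + 2)) m) (u u' : TangentSpace (𝓡 (d + 1)) e)
    (hu : (mfderiv (𝓡 (d + 2)) (𝓡 (d + 1)) pr m X : EuclideanSpace ℝ (Fin (d + 1))) = u)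
    (hu' : (mfderiv (𝓡 (d + 2)) (𝓡 (d + 1)) pr m X' : EuclideanSpace ℝ (Fin (d + 1))) = u') :
    g m X X' = g (σ e) (mfderiv (𝓡 (d + 1)) (𝓡 (d + 2)) σ e u)
        (mfderiv (𝓡 (d + 1)) (𝓡 (d + 2)) σ e u')
      + dReal (hpr.fibreCoord hσ) m X *
        g (σ e) (n (σ e)) (mfderiv (𝓡 (d + 1)) (𝓡 (d + 2)) σ e u')
      + dReal (hpr.fibreCoord hσ) m X' *
        g (σ e) (n (σ e)) (mfderiv (𝓡 (d + 1)) (𝓡 (d + 2)) σ e u) := by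
  subst hm
  conv_lhs =>
    rw [eq_translate_of_proj hpr hσ hfd hc hn hσd e y X u hu,
      eq_translate_of_proj hpr hσ hfd hc hn hσd e y X' u' hu',
      hn.metric_invariant (hpr.mdifferentiable_translation hc)]
  simp only [map_add, map_smul, _root_.add_apply, _root_.smul_apply, smul_eq_mul, hn.lightlike]
  rw [hs (σ e) (mfderiv (𝓡 (d + 1)) (𝓡 (d + 2)) σ e u) (n (σ e))]
  ring

end Decomposition

/-! ### The diffeomorphism with `T × S × ℝ` -/

section Isometry

variable {d : ℕ} {r : ℕ∞ω} {M : Type*} [TopologicalSpace M]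
  [ChartedSpace (EuclideanSpace ℝ (Fin (d + 2))) M]
  {E : Type*} [TopologicalSpace E] [ChartedSpace (EuclideanSpace ℝ (Fin (d + 1))) E]
  {S : Type*} [TopologicalSpace S] [ChartedSpace (EuclideanSpace ℝ (Fin d)) S]
  {c c' : ℕ∞ω} {pr : M → E} {σ : E → M} {T : TopologicalSpace.Opens ℝ}

/-- Chain rule for `(σ ∘ F⁻¹) ∘ F = σ`; it lets quantities defined on `T × S` be computed on `E`. -/
theorem dTS_comp_mfderiv (hσd : MDifferentiable (𝓡 (d + 1)) (𝓡 (d + 2)) σ) (hc' : c' ≠ 0)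
    (F : Diffeomorph (𝓡 (d + 1)) (𝓘(ℝ, ℝ).prod (𝓡 d)) E (T × S) c')
    {t : E → ℝ} {p : E → S} (ht : MDifferentiable (𝓡 (d + 1)) 𝓘(ℝ, ℝ) t)
    (hF1 : ∀ e, ((F e).1 : ℝ) = t e) (hF2 : ∀ e, (F e).2 = p e) (e : E)
    (u : TangentSpace (𝓡 (d + 1)) e) :
    (dTS (fun x ↦ σ (F.symm x)) (F e) (dReal t e u, mfderiv (𝓡 (d + 1)) (𝓡 d) p e u) :
      EuclideanSpace ℝ (Fin (d + 2))) = mfderiv (𝓡 (d + 1)) (𝓡 (d + 2)) σ e u := by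
  have hFd := F.contMDiff.mdifferentiable hc'
  refine (congrArg (dTS _ (F e)) (mfderiv_timeSpace ht hFd hF1 hF2 e u).symm).trans ?_
  have hG : MDifferentiableAt (𝓘(ℝ, ℝ).prod (𝓡 d)) (𝓡 (d + 2)) (fun x ↦ σ (F.symm x)) (F e) :=
    (hσd _).comp _ (F.symm.contMDiff.mdifferentiable hc' (F e))
  have h1 : (fun x ↦ σ (F.symm x)) ∘ F = σ := by
    funext e
    exact congrArg σ (F.symm_apply_apply e)
  have h2 := DFunLike.congr_fun (mfderiv_comp e hG (hFd e)) u
  have h3 : (mfderiv (𝓡 (d + 1)) (𝓡 (d + 2)) ((fun x ↦ σ (F.symm x)) ∘ F) e u :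
      EuclideanSpace ℝ (Fin (d + 2))) = mfderiv (𝓡 (d + 1)) (𝓡 (d + 2)) σ e u := by rw [h1]
  exact h2.symm.trans h3

variable [AddAction ℝ M]

/-- The diffeomorphism `M ≅ T × S × ℝ` obtained from an identification of the base with `T × S` and
a section. -/
noncomputable def bundleDiffeomorph (hpr : IsPrincipalLineBundle (k := d + 2) (l := d + 1) c pr)
    (hσ : ∀ e, pr (σ e) = e) (hc : c' ≤ c) (hσc : ContMDiff (𝓡 (d + 1)) (𝓡 (d + 2)) c' σ)
    (F : Diffeomorph (𝓡 (d + 1)) (𝓘(ℝ, ℝ).prod (𝓡 d)) E (T × S) c') :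
    Diffeomorph (𝓡 (d + 2)) (modelTSR d) M (T × S × ℝ) c' where
  toFun m := ((F (pr m)).1, (F (pr m)).2, hpr.fibreCoord hσ m)
  invFun x := x.2.2 +ᵥ σ (F.symm (x.1, x.2.1))
  left_inv m := by
    change hpr.fibreCoord hσ m +ᵥ σ (F.symm (F (pr m))) = m
    rw [F.symm_apply_apply]
    exact hpr.fibreCoord_vadd hσ m
  right_inv x := by
    have h1 : F (pr (x.2.2 +ᵥ σ (F.symm (x.1, x.2.1)))) = (x.1, x.2.1) := by
      rw [hpr.invariant, hσ, F.apply_symm_apply]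
    simp only [h1, hpr.fibreCoord_vadd_section hσ]
  contMDiff_toFun := by
    have h1 : ContMDiff (𝓡 (d + 2)) (𝓘(ℝ, ℝ).prod (𝓡 d)) c' (fun m ↦ F (pr m)) :=
      F.contMDiff.comp (hpr.contMDiff_proj.of_le hc)
    exact h1.fst.prodMk (h1.snd.prodMk (hpr.contMDiff_fibreCoord hσ hc hσc))
  contMDiff_invFun := by
    have h1 : ContMDiff (modelTSR d) (𝓡 (d + 2)) c'
        (fun x : T × S × ℝ ↦ σ (F.symm (x.1, x.2.1))) :=
      (hσc.comp F.symm.contMDiff).comp (contMDiff_fst.prodMk contMDiff_snd.fst)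
    exact (hpr.contMDiff_action.of_le hc).comp (contMDiff_snd.snd.prodMk h1)

theorem mfderiv_bundleDiffeomorph (hpr : IsPrincipalLineBundle (k := d + 2) (l := d + 1) c pr)
    (hσ : ∀ e, pr (σ e) = e) (hc : c' ≤ c) (hc' : c' ≠ 0)
    (hσc : ContMDiff (𝓡 (d + 1)) (𝓡 (d + 2)) c' σ)
    (F : Diffeomorph (𝓡 (d + 1)) (𝓘(ℝ, ℝ).prod (𝓡 d)) E (T × S) c')
    {t : E → ℝ} {p : E → S} (ht : MDifferentiable (𝓡 (d + 1)) 𝓘(ℝ, ℝ) t)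
    (hF1 : ∀ e, ((F e).1 : ℝ) = t e) (hF2 : ∀ e, (F e).2 = p e) (m : M)
    (X : TangentSpace (𝓡 (d + 2)) m) :
    (mfderiv (𝓡 (d + 2)) (modelTSR d) (bundleDiffeomorph hpr hσ hc hσc F) m X :
        ℝ × EuclideanSpace ℝ (Fin d) × ℝ) =
      (dReal t (pr m) (mfderiv (𝓡 (d + 2)) (𝓡 (d + 1)) pr m X),
        mfderiv (𝓡 (d + 1)) (𝓡 d) p (pr m) (mfderiv (𝓡 (d + 2)) (𝓡 (d + 1)) pr m X),
        dReal (hpr.fibreCoord hσ) m X) := by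
  have hprd : MDifferentiableAt (𝓡 (d + 2)) (𝓡 (d + 1)) pr m :=
    (hpr.contMDiff_proj.of_le hc).mdifferentiable hc' m
  have hFd := F.contMDiff.mdifferentiable hc'
  have hFp : MDifferentiableAt (𝓡 (d + 2)) (𝓘(ℝ, ℝ).prod (𝓡 d)) (fun m ↦ F (pr m)) m :=
    (hFd (pr m)).comp m hprd
  have hfd : MDifferentiableAt (𝓡 (d + 2)) 𝓘(ℝ, ℝ) (hpr.fibreCoord hσ) m :=
    (hpr.contMDiff_fibreCoord hσ hc hσc).mdifferentiable hc' m
  have h1 : (mfderiv (𝓡 (d + 2)) (𝓘(ℝ, ℝ).prod (𝓡 d)) (fun m ↦ F (pr m)) m X :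
        ℝ × EuclideanSpace ℝ (Fin d)) =
      (dReal t (pr m) (mfderiv (𝓡 (d + 2)) (𝓡 (d + 1)) pr m X),
        mfderiv (𝓡 (d + 1)) (𝓡 d) p (pr m) (mfderiv (𝓡 (d + 2)) (𝓡 (d + 1)) pr m X)) :=
    (DFunLike.congr_fun (mfderiv_comp m (hFd (pr m)) hprd) X).trans
      (mfderiv_timeSpace ht hFd hF1 hF2 (pr m) _)
  have h2 : (mfderiv (𝓡 (d + 2)) (𝓘(ℝ, ℝ).prod (𝓡 d)) (fun m ↦ F (pr m)) m X :
        ℝ × EuclideanSpace ℝ (Fin d)) =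
      (mfderiv (𝓡 (d + 2)) 𝓘(ℝ, ℝ) (fun m ↦ (F (pr m)).1) m X,
        mfderiv (𝓡 (d + 2)) (𝓡 d) (fun m ↦ (F (pr m)).2) m X) :=
    DFunLike.congr_fun (mfderiv_prodMk hFp.fst hFp.snd) X
  have h3 := h2.symm.trans h1
  have h4 := DFunLike.congr_fun (mfderiv_prodMk hFp.fst (hFp.snd.prodMk hfd)) X
  have h5 := DFunLike.congr_fun (mfderiv_prodMk hFp.snd hfd) X
  obtain ⟨h6, h7⟩ := Prod.mk.inj h3
  exact h4.trans (congrArg₂ Prod.mk h6 (h5.trans (congrArg₂ Prod.mk h7 rfl)))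

end Isometry

/-! ### Assembly of the Eisenhart form -/

section Main

variable {d : ℕ} {r : ℕ∞ω} {M : Type*} [TopologicalSpace M]
  [ChartedSpace (EuclideanSpace ℝ (Fin (d + 2))) M]
  {E : Type*} [TopologicalSpace E] [ChartedSpace (EuclideanSpace ℝ (Fin (d + 1))) E]
  {S : Type*} [TopologicalSpace S] [ChartedSpace (EuclideanSpace ℝ (Fin d)) S]
  [AddAction ℝ M] {g : BilinField (d + 2) M} {Θ n : VField (d + 2) M} {pr : M → E} {t ψ : M → ℝ}
  {om : ∀ m : M, kerN g n m →ₗ[ℝ] ℝ} {σ : E → M}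

theorem dReal_section {c c' : ℕ∞ω} (hpr : IsPrincipalLineBundle (k := d + 2) (l := d + 1) c pr)
    (hn : IsLightlikeKilling g Θ n) (ht : IsGloballyIntegrable c' g n t ψ)
    (hσ : ∀ e, pr (σ e) = e) (hσd : MDifferentiable (𝓡 (d + 1)) (𝓡 (d + 2)) σ) (e : E)
    (u : TangentSpace (𝓡 (d + 1)) e) :
    dReal t (σ e) (mfderiv (𝓡 (d + 1)) (𝓡 (d + 2)) σ e u) = dReal (onBase pr t) e u := by
  rw [onBase_eq_comp_section hpr (ht.t_invariant hn) hσ]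
  exact (DFunLike.congr_fun (mfderiv_comp e (ht.mdifferentiable (σ e)) (hσd e)) u).symm

theorem EisenhartData.a_congr {T : TopologicalSpace.Opens ℝ} [IsManifold (𝓡 d) 1 S]
    (D : EisenhartData d r T S) {τ τ' : T} {q q' : S} (hτ : τ = τ') (hq : q = q')
    (u v : EuclideanSpace ℝ (Fin d)) :
    (D.a τ q : TangentSpace (𝓡 d) q → TangentSpace (𝓡 d) q →L[ℝ] ℝ) u v =
      (D.a τ' q' : TangentSpace (𝓡 d) q' → TangentSpace (𝓡 d) q' →L[ℝ] ℝ) u v := by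
  subst hτ hq; rfl

theorem EisenhartData.b_congr {T : TopologicalSpace.Opens ℝ} [IsManifold (𝓡 d) 1 S]
    (D : EisenhartData d r T S) {τ τ' : T} {q q' : S} (hτ : τ = τ') (hq : q = q')
    (u : EuclideanSpace ℝ (Fin d)) :
    (D.b τ q : TangentSpace (𝓡 d) q → ℝ) u = (D.b τ' q' : TangentSpace (𝓡 d) q' → ℝ) u := by
  subst hτ hq; rfl

/-- `σ_* u` lies in `ker n` and is not a multiple of `n`, since it projects to `u ≠ 0`. -/
theorem metric_section_pos {c c' : ℕ∞ω}
    (hg : ∀ x, IsLorentzForm (fun X Y : TangentSpace (𝓡 (d + 2)) x ↦ g x X Y))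
    (hn : IsLightlikeKilling g Θ n)
    (hpr : IsPrincipalLineBundle (k := d + 2) (l := d + 1) c pr) (hc : c ≠ 0)
    (ht : IsGloballyIntegrable c' g n t ψ)
    (hσ : ∀ e, pr (σ e) = e) (hσd : MDifferentiable (𝓡 (d + 1)) (𝓡 (d + 2)) σ) {e : E}
    {u : TangentSpace (𝓡 (d + 1)) e} (hu : u ≠ 0) (htu : dReal (onBase pr t) e u = 0) :
    0 < g (σ e) (mfderiv (𝓡 (d + 1)) (𝓡 (d + 2)) σ e u)
      (mfderiv (𝓡 (d + 1)) (𝓡 (d + 2)) σ e u) := by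
  refine (hg (σ e)).pos_of_orthogonal_null (hn.ne_zero _) (hn.lightlike _) ?_ fun a ha ↦ hu ?_
  · exact ht.mem_kerN_iff.2 ((dReal_section hpr hn ht hσ hσd e u).trans htu)
  · have h := hpr.mfderiv_proj_section hc hσ hσd e u
    rw [ha, map_smul, hpr.mfderiv_proj_generator hc hn.flow, smul_zero] at h
    exact h.symm

variable [IsManifold (𝓡 (d + 2)) 1 M] [IsManifold (𝓡 (d + 1)) 1 E]
  [IsManifold (𝓡 (d + 1)) (r + 1) E] [IsManifold (𝓡 d) 1 S]
  [IsManifold (𝓡 d) (r + 1) S]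

theorem exists_eisenhart [ConnectedSpace E]
    (hg : IsSpacetime (r + 1) g Θ) (hn : IsLightlikeKilling g Θ n)
    (hpr : IsPrincipalLineBundle (k := d + 2) (l := d + 1) (r + 1 + 1) pr)
    (ht : IsGloballyIntegrable (r + 1) g n t ψ)
    (hσc : ContMDiff (𝓡 (d + 1)) (𝓡 (d + 2)) (r + 1) σ) (hσ : ∀ e, pr (σ e) = e)
    {w : VField (d + 1) E} (hw : IsNewtonianFrame (r + 1) (onBase pr t) (onBase pr ψ) w)
    (how : IsAssociated g n pr om w)
    {p : E → S} (hp : IsSpaceOfFrame (d := d) (r + 1) (onBase pr t) w p) :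
    ∃ (T : TopologicalSpace.Opens ℝ) (D : EisenhartData d r T S)
      (Φ : Diffeomorph (𝓡 (d + 2)) (modelTSR d) M (T × S × ℝ) (r + 1)),
      (T : Set ℝ) = Set.range t ∧
      D.IsSpaceMetric g pr (onBase pr t) p ∧
      D.IsCoriolisForm g n om σ (onBase pr t) p ∧
      (∀ m, ((Φ m).1 : ℝ) = t m ∧ (Φ m).2.1 = p (pr m)) ∧
      (∀ e, (Φ (σ e)).2.2 = 0) ∧
      (∀ m, mfderiv (𝓡 (d + 2)) (modelTSR d) Φ m (n m) = (0, 0, 1)) ∧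
      (∀ m, D.ψ (Φ m).1 (Φ m).2.1 = ψ m) ∧
      IsEisenhartIsometry D Φ g Θ := by
  have hc' : r + 1 ≠ 0 := by simp
  have hc : r + 1 + 1 ≠ 0 := by simp
  have hcc : r + 1 ≤ r + 1 + 1 := self_le_add_right _ _
  have hσd := hσc.mdifferentiable hc'
  have hd := hpr.mdifferentiable_translation hc
  have hs (m : M) (X Y : TangentSpace (𝓡 (d + 2)) m) : g m X Y = g m Y X :=
    (hg.lorentz m).symm X Y
  have htE : ContMDiff (𝓡 (d + 1)) 𝓘(ℝ, ℝ) (r + 1) (onBase pr t) := by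
    rw [onBase_eq_comp_section hpr (ht.t_invariant hn) hσ]
    exact (ht.contMDiff_t.of_le (self_le_add_right _ _)).comp hσc
  have htEd := htE.mdifferentiable hc'
  have hψE (e : E) : onBase pr ψ e = ψ (σ e) :=
    congrFun (onBase_eq_comp_section hpr (ht.ψ_invariant hn hg.lorentz hd) hσ) e
  have hwt (e : E) : ψ (σ e) * dReal (onBase pr t) e (w e) = 1 := hψE e ▸ hw.normalized e
  have hwpos (e : E) : 0 < dReal (onBase pr t) e (w e) :=
    pos_of_mul_pos_right (a := ψ (σ e)) (by rw [hwt e]; exact one_pos) (ht.ψ_pos _).le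
  let T : TopologicalSpace.Opens ℝ := ⟨range (onBase pr t), hp.isOpen_range htEd hwpos⟩
  obtain ⟨F, hF1, hF2⟩ := hp.exists_diffeomorph (T := T) hc' htE hwpos rfl
  have hFG (e : E) : F.symm (F e) = e := F.symm_apply_apply e
  set G : T × S → M := fun x ↦ σ (F.symm x)
  have hG : ContMDiff (𝓘(ℝ, ℝ).prod (𝓡 d)) (𝓡 (d + 2)) (r + 1) G := hσc.comp F.symm.contMDiff
  have hGF (e : E) : G (F e) = σ e := congrArg σ (hFG e)
  have hdG (e : E) (u : TangentSpace (𝓡 (d + 1)) e) (ξ : ℝ × EuclideanSpace ℝ (Fin d))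
      (hξ : (dReal (onBase pr t) e u, mfderiv (𝓡 (d + 1)) (𝓡 d) p e u) = ξ) :
      (dTS G (F e) ξ : EuclideanSpace ℝ (Fin (d + 2))) =
        mfderiv (𝓡 (d + 1)) (𝓡 (d + 2)) σ e u :=
    (congrArg (dTS G (F e)) hξ.symm).trans (dTS_comp_mfderiv hσd hc' F htEd hF1 hF2 e u)
  have hdF := fun e ↦ mfderiv_timeSpace htEd (F.contMDiff.mdifferentiable hc') hF1 hF2 e
  have hFsurj (e : E) (ξ : ℝ × EuclideanSpace ℝ (Fin d)) : ∃ u : TangentSpace (𝓡 (d + 1)) e,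
      (dReal (onBase pr t) e u, mfderiv (𝓡 (d + 1)) (𝓡 d) p e u) = ξ := by
    refine ⟨(F.mfderivToContinuousLinearEquiv hc' e).symm ξ, (hdF e _).symm.trans ?_⟩
    exact (F.mfderivToContinuousLinearEquiv hc' e).apply_symm_apply ξ
  have hpos (x : T × S) (v : TangentSpace (𝓡 d) x.2) (hv : v ≠ 0) : 0 < sliceMetric g G x v v := by
    obtain ⟨e, rfl⟩ := F.surjective x
    obtain ⟨u, hu⟩ := hFsurj e (0, v)
    have hu0 : u ≠ 0 := by
      rintro rfl
      exact hv ((congrArg Prod.snd hu).symm.trans (map_zero (mfderiv (𝓡 (d + 1)) (𝓡 d) p e)))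
    have h1 := hdG e u _ hu
    have h2 := metric_section_pos hg.lorentz hn hpr hc ht hσ hσd hu0 (congrArg Prod.fst hu)
    rw [sliceMetric_apply]
    exact h2.trans_eq (bilinField_congr g (hGF e).symm h1.symm h1.symm)
  have hrr : r ≤ r + 1 := self_le_add_right _ _
  let D : EisenhartData d r T S := pullbackData (r := r) (ψ := ψ) hs ht.ψ_pos hpos
    (hg.contMDiff.of_le hrr) hG (ht.contMDiff_ψ.of_le hrr)
  let Φ := bundleDiffeomorph hpr hσ hcc hσc F
  have hfd := (hpr.contMDiff_fibreCoord hσ hcc hσc).mdifferentiable hc'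
  have hdΦ := fun m X ↦ mfderiv_bundleDiffeomorph hpr hσ hcc hc' hσc F htEd hF1 hF2 m X
  have hdt (m : M) (X : TangentSpace (𝓡 (d + 2)) m) :
      dReal (onBase pr t) (pr m) (mfderiv (𝓡 (d + 2)) (𝓡 (d + 1)) pr m X) = dReal t m X :=
    dReal_onBase hpr hc (ht.t_invariant hn) m (htEd _) X
  have hΦ1 (m : M) : ((Φ m).1 : ℝ) = t m :=
    (hF1 (pr m)).trans (onBase_proj hpr (ht.t_invariant hn) m)
  have hψΦ (m : M) : D.ψ (Φ m).1 (Φ m).2.1 = ψ m := by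
    change ψ (G (F (pr m))) = ψ m
    rw [hGF]
    conv_rhs => rw [← hpr.fibreCoord_vadd hσ m, ht.ψ_invariant hn hg.lorentz hd]
  have hform (e : E) (u : TangentSpace (𝓡 (d + 1)) e) :
      g (σ e) (n (σ e)) (mfderiv (𝓡 (d + 1)) (𝓡 (d + 2)) σ e u) =
        -(ψ (G (F e)) * dReal (onBase pr t) e u) := by
    rw [ht.n_eq, dReal_section hpr hn ht hσ hσd, hGF]
  have hmetric (m : M) (X Y : TangentSpace (𝓡 (d + 2)) m) :
      g m X Y = D.metric (Φ m)
        (dReal (onBase pr t) (pr m) (mfderiv (𝓡 (d + 2)) (𝓡 (d + 1)) pr m X),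
          mfderiv (𝓡 (d + 1)) (𝓡 d) p (pr m) (mfderiv (𝓡 (d + 2)) (𝓡 (d + 1)) pr m X),
          dReal (hpr.fibreCoord hσ) m X)
        (dReal (onBase pr t) (pr m) (mfderiv (𝓡 (d + 2)) (𝓡 (d + 1)) pr m Y),
          mfderiv (𝓡 (d + 1)) (𝓡 d) p (pr m) (mfderiv (𝓡 (d + 2)) (𝓡 (d + 1)) pr m Y),
          dReal (hpr.fibreCoord hσ) m Y) := by
    set u := mfderiv (𝓡 (d + 2)) (𝓡 (d + 1)) pr m X with hu
    set v := mfderiv (𝓡 (d + 2)) (𝓡 (d + 1)) pr m Y with hv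
    have h1 := metric_eq_of_proj hpr hσ hfd hc hn hs hσd (hpr.fibreCoord_vadd hσ m) X Y u v rfl rfl
    have h2 := bilinField_congr g (hGF (pr m)) (hdG (pr m) u _ rfl) (hdG (pr m) v _ rfl)
    have h3 := pullback_apply g G ψ (F (pr m)) (hs _) (ht.ψ_pos _).ne'
      (dReal (onBase pr t) (pr m) u) (dReal (onBase pr t) (pr m) v)
      (mfderiv (𝓡 (d + 1)) (𝓡 d) p (pr m) u) (mfderiv (𝓡 (d + 1)) (𝓡 d) p (pr m) v)
    rw [hform, hform] at h1
    refine h1.trans (Eq.trans (congrArg (fun z ↦ z + _ + _) (h2.symm.trans h3)) ?_)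
    change _ = sliceMetric g G (F (pr m)) _ _ +
      -(ψ (G (F (pr m))) * dReal (onBase pr t) (pr m) u) *
        (dReal (hpr.fibreCoord hσ) m Y - sliceForm g G ψ (F (pr m)) _) +
      (dReal (hpr.fibreCoord hσ) m X - sliceForm g G ψ (F (pr m)) _) *
        -(ψ (G (F (pr m))) * dReal (onBase pr t) (pr m) v) -
      (2 * slicePotential g G ψ (F (pr m)) + 1) *
        (-(ψ (G (F (pr m))) * dReal (onBase pr t) (pr m) u) *
          -(ψ (G (F (pr m))) * dReal (onBase pr t) (pr m) v))
    ring
  refine ⟨T, D, Φ, ?_, ?_, ?_, fun m ↦ ⟨hΦ1 m, hF2 (pr m)⟩, fun e ↦ ?_, fun m ↦ ?_, hψΦ, ?_⟩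
  · ext τ
    constructor
    · rintro ⟨e, rfl⟩
      exact ⟨σ e, (congrFun (onBase_eq_comp_section hpr (ht.t_invariant hn) hσ) e).symm⟩
    · rintro ⟨m, rfl⟩
      exact ⟨pr m, onBase_proj hpr (ht.t_invariant hn) m⟩
  · rintro τ m hτ _ _ hu0 hv0 W V rfl rfl
    refine Eq.trans ?_ (hmetric m W V).symm
    change _ = D.a (Φ m).1 (Φ m).2.1 _ _ + -(D.ψ (Φ m).1 (Φ m).2.1 * _) * _ +
      _ * -(D.ψ (Φ m).1 (Φ m).2.1 * _) -
      (2 * D.U (Φ m).1 (Φ m).2.1 + 1) * (-(D.ψ (Φ m).1 (Φ m).2.1 * _) * _)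
    -- Both vectors are tangent to the slice, so every term containing `n` vanishes and only `a`
    -- remains.
    rw [hu0, hv0]
    simp only [mul_zero, neg_zero, zero_mul, add_zero, sub_zero]
    exact D.a_congr (Subtype.ext (hτ.symm.trans (hF1 (pr m)).symm)) (hF2 (pr m)).symm _ _
  · intro τ e hτ u hu
    have hk : mfderiv (𝓡 (d + 1)) (𝓡 (d + 2)) σ e u ∈ kerN g n (σ e) :=
      ht.mem_kerN_iff.2 ((dReal_section hpr hn ht hσ hσd e u).trans hu)
    -- `σ_* w` is a representative of `w`, so `ω = -g(·, σ_* w)` on `ker n`.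
    have hprw : mfderiv (𝓡 (d + 2)) (𝓡 (d + 1)) pr (σ e)
        (mfderiv (𝓡 (d + 1)) (𝓡 (d + 2)) σ e (w e)) = w (pr (σ e)) :=
      (hpr.mfderiv_proj_section hc hσ hσd e (w e)).trans (vfield_congr w (hσ e).symm)
    refine ⟨hk, ?_⟩
    rw [how (σ e) _ hprw ⟨_, hk⟩, neg_neg]
    have h1 : D.b τ (p e) (mfderiv (𝓡 (d + 1)) (𝓡 d) p e u) =
        (ψ (G (F e)))⁻¹ * g (G (F e)) (dTS G (F e) (1, 0))
          (dTS G (F e) (0, mfderiv (𝓡 (d + 1)) (𝓡 d) p e u)) :=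
      D.b_congr (Subtype.ext (hτ.symm.trans (hF1 e).symm)) (hF2 e).symm _
    have h2 := hdG e u (0, mfderiv (𝓡 (d + 1)) (𝓡 d) p e u) (congrArg₂ Prod.mk hu rfl)
    -- In `T × S` the frame is `ψ⁻¹ ∂/∂t`, by `ψ dt[w] = 1` and `p_* w = 0`; this is the vector in
    -- the definition of `sliceForm`.
    have h3 := hdG e (w e) ((ψ (G (F e)))⁻¹ • (1, 0)) (by
      rw [Prod.smul_mk, smul_zero, smul_eq_mul, mul_one, hGF]
      exact congrArg₂ Prod.mk (eq_inv_of_mul_eq_one_right (hwt e)) (hp.mfderiv_frame hc' e))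
    refine h1.trans (Eq.trans ?_ ((bilinField_congr g (hGF e) h3 h2).trans (hs _ _ _)))
    rw [map_smul, map_smul]
    rfl
  · have h := hpr.fibreCoord_vadd_section hσ 0 e
    rwa [zero_vadd] at h
  · refine (hdΦ m (n m)).trans ?_
    rw [hpr.mfderiv_proj_generator hc hn.flow, map_zero, map_zero,
      dReal_fibreCoord_generator hpr hσ hfd hn.flow]
    rfl
  · refine ⟨isConnected_range htEd.continuous, fun m X Y ↦ (hmetric m X Y).trans
      (congrArg₂ (D.metric (Φ m)) (hdΦ m X) (hdΦ m Y)).symm, fun m X hX ↦ ?_⟩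
    -- By nondegeneracy, raising the index of `-ψ dt` gives back `n`, which is future directed.
    have hXn : X - n m = 0 := (hg.lorentz m).eq_zero_of_forall fun Y ↦ by
      have h1 : D.nForm (Φ m) (mfderiv (𝓡 (d + 2)) (modelTSR d) Φ m Y) =
          -(D.ψ (Φ m).1 (Φ m).2.1 *
            dReal (onBase pr t) (pr m) (mfderiv (𝓡 (d + 2)) (𝓡 (d + 1)) pr m Y)) :=
        congrArg (D.nForm (Φ m)) (hdΦ m Y)
      rw [map_sub, _root_.sub_apply, hX, h1, hψΦ, hdt, ht.n_eq, sub_self]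
    rw [sub_eq_zero.1 hXn]
    exact hn.future m

end Main

end Eisenhart

theorem mainTheorem8 (d : ℕ) (r : ℕ∞)
    {M : Type uM} [TopologicalSpace M] [T2Space M] [SecondCountableTopology M] [ConnectedSpace M]
    [ChartedSpace (EuclideanSpace ℝ (Fin (d + 2))) M]
    [IsManifold (𝓡 (d + 2)) 1 M] [IsManifold (𝓡 (d + 2)) (r + 2) M]
    {E : Type uE} [TopologicalSpace E] [T2Space E] [SecondCountableTopology E]
    [ChartedSpace (EuclideanSpace ℝ (Fin (d + 1))) E]
    [IsManifold (𝓡 (d + 1)) 1 E] [IsManifold (𝓡 (d + 1)) (r + 2) E]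
    [AddAction ℝ M]
    (g : Eisenhart.BilinField (d + 2) M) (Θ n : Eisenhart.VField (d + 2) M)
    (hg : Eisenhart.IsSpacetime (r + 1) g Θ)
    (hn : Eisenhart.IsLightlikeKilling g Θ n)
    (pr : M → E) (hpr : Eisenhart.IsPrincipalLineBundle (k := d + 2) (l := d + 1) (r + 2) pr)
    (t ψ : M → ℝ) (ht : Eisenhart.IsGloballyIntegrable (r + 1) g n t ψ)
    (om : ∀ m : M, Eisenhart.kerN g n m →ₗ[ℝ] ℝ)
    (hom : Eisenhart.IsConnectionFamily (r + 1) g n om)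
    (σ : E → M) (hσ : ContMDiff (𝓡 (d + 1)) (𝓡 (d + 2)) (r + 1) σ)
    (hprσ : ∀ e, pr (σ e) = e) :
    (∃! w : Eisenhart.VField (d + 1) E,
      Eisenhart.IsNewtonianFrame (r + 1) (Eisenhart.onBase pr t) (Eisenhart.onBase pr ψ) w ∧
      Eisenhart.IsAssociated g n pr om w) ∧
    ∀ w : Eisenhart.VField (d + 1) E,
      Eisenhart.IsNewtonianFrame (r + 1) (Eisenhart.onBase pr t) (Eisenhart.onBase pr ψ) w →
      Eisenhart.IsAssociated g n pr om w →
      ∀ {S : Type uS} [TopologicalSpace S] [T2Space S] [SecondCountableTopology S]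
        [ChartedSpace (EuclideanSpace ℝ (Fin d)) S]
        [IsManifold (𝓡 d) 1 S] [IsManifold (𝓡 d) (r + 1) S] (p : E → S),
        Eisenhart.IsSpaceOfFrame (d := d) (r + 1) (Eisenhart.onBase pr t) w p →
        (∃ (T : TopologicalSpace.Opens ℝ) (D : Eisenhart.EisenhartData d r T S)
          (Φ : Diffeomorph (𝓡 (d + 2)) (Eisenhart.modelTSR d) M (T × S × ℝ) (r + 1)),
          (T : Set ℝ) = Set.range t ∧
          D.IsSpaceMetric g pr (Eisenhart.onBase pr t) p ∧
          D.IsCoriolisForm g n om σ (Eisenhart.onBase pr t) p ∧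
          (∀ m, ((Φ m).1 : ℝ) = t m ∧ (Φ m).2.1 = p (pr m)) ∧
          (∀ e, (Φ (σ e)).2.2 = 0) ∧
          (∀ m, mfderiv (𝓡 (d + 2)) (Eisenhart.modelTSR d) Φ m (n m) = (0, 0, 1)) ∧
          (∀ m, D.ψ (Φ m).1 (Φ m).2.1 = ψ m) ∧
          Eisenhart.IsEisenhartIsometry D Φ g Θ) ∧
        (1 ≤ r → Eisenhart.IsEisenhartSpacetime.{uS} d g Θ) := by 
  have hr : ((r : ℕ∞ω) + 1 : ℕ∞ω) + 1 = r + 2 := by rw [add_assoc, one_add_one_eq_two]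
  have hr0 : (r : ℕ∞ω) + 1 ≠ 0 := by simp
  have hr2 : (r : ℕ∞ω) + 1 ≤ r + 2 := hr ▸ self_le_add_right _ _
  have : IsManifold (𝓡 (d + 1)) (r + 1) E := IsManifold.of_le hr2
  have : ConnectedSpace E := hpr.surjective.connectedSpace hpr.contMDiff_proj.continuous
  -- The class `r + 2` must appear as one more than `r + 1`, the class of the metric and the
  -- section.
  rw [← hr] at hpr
  refine ⟨Eisenhart.existsUnique_frame hr0 hg hn hpr ht hom hσ hprσ, ?_⟩
  intro w hw how S _ _ _ _ _ _ p hp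
  have h := Eisenhart.exists_eisenhart hg hn hpr ht hσ hprσ hw how hp
  refine ⟨h, fun h1 ↦ ?_⟩
  obtain ⟨T, D, Φ, -, -, -, -, -, -, -, hΦ⟩ := h
  exact ⟨r, S, inferInstance, inferInstance, inferInstance, T, D, Φ, h1, inferInstance,
    inferInstance, inferInstance, hΦ⟩
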